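/- **Setting.** Let $N\ge 1$ be an integer, $r\in\mathbb R\setminus\{0\}$, and let $q$ be either a nonzero real number or $q=e^{i\pi\varphi}$ with $\varphi\in\mathbb R$, $|\varphi|<\frac1{2N}$. Write $[n]_q=\frac{q^n-q^{-n}}{q-q^{-1}}$ (extended by continuity to $q=\pm1$), and assume that the denominators below do not vanish, i.e. $[N]_q[N+2]_q\ne0$ and $[2]_{q^{N+1}}\neq 0$. Put $$\Lambda_N=r\,\frac{[2]_{q^{N+1}}}{\sqrt{[N]_q[N+2]_q}} .$$ Repeated indices are summed. Vector indices run over $1,0,-1$, and $g^{ij}=g_{ij}$, $\varepsilon^{ij}_k=\varepsilon_{ij}^k=\varepsilon_k^{ij}$ have the only nonzero entries $g^{1,-1}=-q^{-1}$, $g^{00}=1$, $g^{-1,1}=-q$ and $$\varepsilon^{10}_1=q^{-1},\ \varepsilon^{01}_1=-q,\ \varepsilon^{00}_0=-(q-q^{-1}),\ \varepsilon^{1,-1}_0=1=-\varepsilon^{-1,1}_0,\ \varepsilon^{0,-1}_{-1}=q^{-1},\ \varepsilon^{-1,0}_{-1}=-q;$$ $\varepsilon^{ijk}=g^{in}\varepsilon_n^{jk}$,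 and $\hat R=q^2P^+-q^{-2}P^-+q^{-4}P^0$ with $(P^0)^{kl}_{ij}=\frac1{[3]_q}g^{kl}g_{ij}$, $(P^-)^{kl}_{ij}=\frac1{[2]_{q^2}}\varepsilon^{kl}_n\varepsilon^n_{ij}$, $P^+=1-P^--P^0$. *The fuzzy sphere.* Let $A_\alpha,A^{+\alpha}$ ($\alpha=\pm$) be the $q$-oscillators on their Fock space, $A_\alpha|0\rangle=0$, $$A^{+\alpha}A_\beta=\delta^\alpha_\beta+q\hat R^{\alpha\gamma}_{\beta\delta}A_\gamma A^{+\delta},\quad \varepsilon^{\alpha\beta}A_\alpha A_\beta=0,\quad \varepsilon_{\gamma\delta}A^{+\delta}A^{+\gamma}=0,$$ where $\varepsilon^{+-}=q^{-1/2}$, $\varepsilon^{-+}=-q^{1/2}$, $\varepsilon_{\alpha\beta}=-\varepsilon^{\alpha\beta}$ and $\hat R^{\alpha\gamma}_{\beta\delta}=q\,\delta^\alpha_\beta\delta^\gamma_\delta+\varepsilon^{\alpha\gamma}\varepsilon_{\beta\delta}$ is the spin-$\frac12$ $\hat R$-matrix. Let $\hat Z_i=A^{+\alpha'}\varepsilon^{\alpha\alpha'}\sigma_i^{\alpha\beta}A_\beta$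 with $\sigma_1^{++}=\sigma_{-1}^{--}=1$, $\sigma_0^{+-}=q^{1/2}/\sqrt{[2]_q}$, $\sigma_0^{-+}=q^{-1/2}/\sqrt{[2]_q}$ (other entries zero), and let $$x_i=\frac{r\,q^{N+2}\sqrt{[2]_q}}{\sqrt{[N]_q[N+2]_q}}\ \hat Z_i .$$ $\mathcal S^2_{q,N}$ is the algebra of operators generated by $x_1,x_0,x_{-1}$ on the $N$-particle space $\mathcal F_N$. *The elements $L^+$.* Put (with inverse taken in $\mathcal S^2_{q,N}$) $$q^{-H}=\tfrac{[2]_{q^{N+1}}}{[2]_q}+\tfrac{q^{N+2}(q-q^{-1})}{\sqrt{[2]_q}}\hat Z_0,\qquad q^{H}=(q^{-H})^{-1},\qquad X^-q^{-H/2}=-q^{N+1}\hat Z_{-1},$$ in $\mathcal S^2_{q,N}$. Let $\mathcal R=\mathcal R_1\otimes\mathcal R_2=q^{\frac12 H\otimes H}\sum_n \frac{q^{n(n-1)/2}(q-q^{-1})^n}{[n]_q!}\,(X^-q^{-H/2})^n\otimes(q^{H/2}X^+)^n$, let $\pi$ be the three-dimensional representation of $U_q(su(2))$ with $He_i=2ie_i$,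 $X^+e_0=\sqrt{[2]_q}\,e_1$, $X^+e_{-1}=\sqrt{[2]_q}\,e_0$, $X^+e_1=0$, and let $S$ be the antipode, $S(q^{H})=q^{-H}$, $S(X^-q^{-H/2})=-X^-q^{-H/2}q^{H}$. Set $L^{+i}{}_j=\mathcal R_1\,\pi^i_j(\mathcal R_2)$ and $S(L^{+i}{}_j)=S(\mathcal R_1)\,\pi^i_j(\mathcal R_2)$, as elements of $\mathcal S^2_{q,N}$. *The calculus.* $\Omega^*=\bigoplus_n\Omega^n$ is the algebra generated by $\mathcal S^2_{q,N}$ and $\xi_1,\xi_0,\xi_{-1}$ with relations $x_i\xi_j=\hat R^{kl}_{ij}\xi_kx_l$, $\xi_i\xi_j=-q^2\hat R^{kl}_{ij}\xi_k\xi_l$, where $\Omega^n$ is spanned by the elements $\xi_{i_1}\cdots\xi_{i_n}f$, $f\in\mathcal S^2_{q,N}$. Let $\Theta=x_i\xi_jg^{ij}$, $df=[\Theta,f]$ for $f\in\mathcal S^2_{q,N}$, and $d\alpha=\Theta\alpha+\alpha\Theta-\ast_H\alpha$ for $\alpha\in\Omega^1$, where $\ast_H:\Omega^1\to\Omega^2$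 is the left and right $\mathcal S^2_{q,N}$-module map with $\ast_H\xi_i=-\frac{q^{-2}\Lambda_N}{[2]_{q^2}}\varepsilon_i^{jk}\xi_j\xi_k$. Put $$\theta^a=\Lambda_N\,S(L^{+a}{}_j)\,g^{jk}\xi_k\in\Omega^1,\qquad \lambda_a=\frac1{\Lambda_N}\,x_i\,L^{+i}{}_a\in\mathcal S^2_{q,N}.$$ **Lemma.** The map $\ast_H$ exists and is unique; every $\alpha\in\Omega^1$ is uniquely of the form $c_a\theta^a$, and every $\alpha\in\Omega^3$ uniquely of the form $f\,\Theta^3$, with $c_a,f\in\mathcal S^2_{q,N}$. For all $f\in\mathcal S^2_{q,N}$ and all indices $a,b,c$, $$[\theta^a,f]=0,\qquad df=[\lambda_a,f]\,\theta^a,\qquad \Theta=\lambda_a\theta^a,$$ $$\lambda_a\lambda_b\,g^{ba}=\frac{r^2}{q^4\Lambda_N^2},\qquad \lambda_a\lambda_b\,\varepsilon_c^{ba}=-\frac1{q^2}\lambda_c,\qquad \theta^a\theta^b=-q^2\hat R^{ba}_{cd}\,\theta^d\theta^c,$$ $$d\theta^a=\lambda_b(\theta^a\theta^b+\theta^b\theta^a)+\frac1{q^2[2]_{q^2}}\varepsilon^a_{bc}\,\theta^c\theta^b,\qquad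 \ast_H\theta^a=-\frac1{q^2[2]_{q^2}}\varepsilon^a_{bc}\,\theta^c\theta^b,$$ $$\theta^a\theta^b\theta^c=-\Lambda_N^2\,\frac{q^6}{r^2}\,\varepsilon^{cba}\,\Theta^3 .$$ -/

import Mathlib

/-!
Index conventions. Spinor indices `α = +, -` are `0, 1 : Fin 2`; vector indices
`i = 1, 0, -1` are `0, 1, 2 : Fin 3`.
-/

namespace QFuzzy

noncomputable section

/-- The `q`-number `[n]_q = (q^n - q^{-n}) / (q - q⁻¹) = q^{n-1} + q^{n-3} + ⋯ + q^{1-n}`,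
written so that it also makes sense at `q = ±1`. -/
def qnum (n : ℕ) (q : ℂ) : ℂ := ∑ k ∈ Finset.range n, q ^ ((n : ℤ) - 1 - 2 * (k : ℤ))

/-- The principal complex square root. -/
def csqrt (z : ℂ) : ℂ := z ^ (1 / 2 : ℂ)

/-! ### Invariant tensors -/

/-- `ε_{αβ}` : `ε_{+-} = -q^{-1/2}`, `ε_{-+} = q^{1/2}`. -/
def epsSpin (q : ℂ) : Fin 2 → Fin 2 → ℂ :=
  ![![0, -(csqrt q)⁻¹], ![csqrt q, 0]]

/-- `σ_i^{αβ}`, as `sig q i α β`. -/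
def sig (q : ℂ) : Fin 3 → Fin 2 → Fin 2 → ℂ :=
  ![![![1, 0], ![0, 0]],
    ![![0, csqrt q / csqrt (qnum 2 q)], ![(csqrt q)⁻¹ / csqrt (qnum 2 q), 0]],
    ![![0, 0], ![0, 1]]]

/-- `g^{ij} = g_{ij}` : `g^{1,-1} = -q⁻¹`, `g^{00} = 1`, `g^{-1,1} = -q`. -/
def g (q : ℂ) : Fin 3 → Fin 3 → ℂ :=
  ![![0, 0, -q⁻¹], ![0, 1, 0], ![-q, 0, 0]]

/-- `ε^{ij}_k = ε_{ij}^k = ε_k^{ij}`, as `eps q i j k`. -/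
def eps (q : ℂ) : Fin 3 → Fin 3 → Fin 3 → ℂ :=
  ![![![0, 0, 0], ![q⁻¹, 0, 0], ![0, 1, 0]],
    ![![-q, 0, 0], ![0, -(q - q⁻¹), 0], ![0, 0, q⁻¹]],
    ![![0, -1, 0], ![0, 0, -q], ![0, 0, 0]]]

/-- `ε^{ijk} = g^{in} ε_n^{jk}`. -/
def epsUp (q : ℂ) (i j k : Fin 3) : ℂ := ∑ n, g q i n * eps q j k n

/-- `(P⁰)^{kl}_{ij} = g^{kl} g_{ij} / [3]_q`. -/
def projZero (q : ℂ) (k l i j : Fin 3) : ℂ := g q k l * g q i j / qnum 3 q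

/-- `(P⁻)^{kl}_{ij} = ∑_n ε^{kl}_n ε^n_{ij} / [2]_{q²}`. -/
def projMinus (q : ℂ) (k l i j : Fin 3) : ℂ :=
  (∑ n, eps q k l n * eps q i j n) / qnum 2 (q ^ 2)

/-- `P⁺ = 1 - P⁻ - P⁰`. -/
def projPlus (q : ℂ) (k l i j : Fin 3) : ℂ :=
  (if k = i ∧ l = j then 1 else 0) - projMinus q k l i j - projZero q k l i j

/-- `R̂^{kl}_{ij} = q² (P⁺)^{kl}_{ij} - q⁻² (P⁻)^{kl}_{ij} + q⁻⁴ (P⁰)^{kl}_{ij}`, as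
`Rhat q k l i j`. -/
def Rhat (q : ℂ) (k l i j : Fin 3) : ℂ :=
  q ^ 2 * projPlus q k l i j - (q ^ 2)⁻¹ * projMinus q k l i j
    + (q ^ 4)⁻¹ * projZero q k l i j

/-! ### The `q`-oscillators on Fock space -/

/-- The Fock space, with basis `|m, n⟩ = (A⁺^{+})^m (A⁺^{-})^n |0⟩`. -/
abbrev Fock : Type := (ℕ × ℕ) →₀ ℂ

/-- The basis vector `|m, n⟩`. -/
def ket (m n : ℕ) : Fock := Finsupp.single (m, n) 1

/-- The creation operators `A⁺^{α}`. -/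
def crea (q : ℂ) : Fin 2 → (Fock →ₗ[ℂ] Fock) :=
  ![Finsupp.linearCombination ℂ fun p : ℕ × ℕ => ket (p.1 + 1) p.2,
    Finsupp.linearCombination ℂ fun p : ℕ × ℕ => q ^ p.1 • ket p.1 (p.2 + 1)]

/-- The annihilation operators `A_α`. Together with `crea` they satisfy
`A⁺^{α} A_β = δ^α_β + q R̂^{αγ}_{βδ} A_γ A⁺^{δ}`, `ε^{αβ} A_α A_β = 0`,
`ε_{γδ} A⁺^{δ} A⁺^{γ} = 0` and `A_α |0⟩ = 0`, see below. -/
def anni (q : ℂ) : Fin 2 → (Fock →ₗ[ℂ] Fock) :=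
  ![Finsupp.linearCombination ℂ fun p : ℕ × ℕ =>
      (-(q ^ (p.1 + 2 * p.2 + 3))⁻¹ * qnum p.1 q) • ket (p.1 - 1) p.2,
    Finsupp.linearCombination ℂ fun p : ℕ × ℕ =>
      (-(q ^ (p.1 + p.2 + 1))⁻¹ * qnum p.2 q) • ket p.1 (p.2 - 1)]

lemma crea_zero_ket (q : ℂ) (m n : ℕ) : crea q 0 (ket m n) = ket (m + 1) n := by
  simp [crea, ket]

lemma crea_one_ket (q : ℂ) (m n : ℕ) : crea q 1 (ket m n) = q ^ m • ket m (n + 1) := by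
  simp [crea, ket]

lemma anni_zero_ket (q : ℂ) (m n : ℕ) :
    anni q 0 (ket m n) = (-(q ^ (m + 2 * n + 3))⁻¹ * qnum m q) • ket (m - 1) n := by
  simp [anni, ket]

lemma anni_one_ket (q : ℂ) (m n : ℕ) :
    anni q 1 (ket m n) = (-(q ^ (m + n + 1))⁻¹ * qnum n q) • ket m (n - 1) := by
  simp [anni, ket]

lemma qnum_zero (q : ℂ) : qnum 0 q = 0 := by simp [qnum]

lemma qnum_succ (q : ℂ) (hq : q ≠ 0) (n : ℕ) : qnum (n + 1) q = q * qnum n q + (q ^ n)⁻¹ := by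
  unfold qnum
  rw [Finset.sum_range_succ, Finset.mul_sum]
  congr 1
  · refine Finset.sum_congr rfl fun k _ => ?_
    rw [← zpow_one_add₀ hq]
    congr 1
    push_cast
    ring
  · rw [← zpow_natCast, ← zpow_neg]
    congr 1
    push_cast
    ring

lemma qnum_succ' (q : ℂ) (hq : q ≠ 0) (n : ℕ) : qnum (n + 1) q = q⁻¹ * qnum n q + q ^ n := by
  unfold qnum
  rw [Finset.sum_range_succ', Finset.mul_sum]
  congr 1
  · refine Finset.sum_congr rfl fun k _ => ?_
    rw [← zpow_neg_one, ← zpow_add₀ hq]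
    congr 1
    push_cast
    ring
  · rw [← zpow_natCast]
    congr 1
    push_cast
    ring

/-- The spin-1/2 `R̂`-matrix `q P⁺ - q⁻¹ P⁻ = q - [2]_q P⁻`, with
`(P⁻)^{αγ}_{βδ} = - ε^{αγ} ε_{βδ} / [2]_q` and `ε^{αγ} = - ε_{αγ}`. -/
def RhatSpin (q : ℂ) (α γ β δ : Fin 2) : ℂ :=
  (if α = β ∧ γ = δ then q else 0) - epsSpin q α γ * epsSpin q β δ


lemma csqrt_mul_self (z : ℂ) : csqrt z * csqrt z = z := by
  by_cases hz : z = 0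
  · simp [csqrt, hz]
  · rw [csqrt, ← Complex.cpow_add _ _ hz]
    norm_num

lemma qnum_mul (q : ℂ) (hq : q ≠ 0) (n : ℕ) :
    q ^ n * (q ^ 2 - 1) * qnum n q = q * (q ^ (2 * n) - 1) := by
  have h := (qnum_succ q hq n).symm.trans (qnum_succ' q hq n)
  field_simp at h
  rw [two_mul, pow_add]
  linear_combination h

/-- `A⁺^{α} A_β = δ^α_β + q R̂^{αγ}_{βδ} A_γ A⁺^{δ}` on the Fock space. -/
theorem oscillator_mixed (q : ℂ) (hq : q ≠ 0) (α β : Fin 2) (m n : ℕ) :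
    crea q α (anni q β (ket m n)) = (if α = β then ket m n else 0)
      + q • ∑ γ, ∑ δ, RhatSpin q α γ β δ • anni q γ (crea q δ (ket m n)) := by
  have hs := csqrt_mul_self q
  have hs0 : csqrt q ≠ 0 := fun h => hq (by rw [← hs, h, zero_mul])
  have hs' : (csqrt q)⁻¹ * (csqrt q)⁻¹ = q⁻¹ := by rw [← mul_inv, hs]
  have h1 := qnum_succ q hq
  fin_cases α <;> fin_cases β <;>
    simp [Fin.sum_univ_two, RhatSpin, epsSpin, crea_zero_ket, crea_one_ket, anni_zero_ket,
      anni_one_ket, hs, hs', hs0, smul_smul]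
  · have hm := qnum_mul q hq m
    have hn := qnum_mul q hq (n + 1)
    have key : -((q ^ (m + 2 * n + 3))⁻¹ * qnum m q) =
        1 + (-(q * (q * ((q ^ (m + 1 + 2 * n + 3))⁻¹ * qnum (m + 1) q))) +
        -(q * ((q + -q⁻¹) * q ^ m * ((q ^ (m + (n + 1) + 1))⁻¹ * qnum (n + 1) q)))) := by
      rw [h1 m]
      field_simp
      ring_nf at hm hn ⊢
      linear_combination q ^ 6 * q ^ (m * 2) * q ^ (n * 3) * hm
        + q ^ 6 * q ^ (m * 4) * q ^ (n * 3) * hn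
    have e : qnum m q • ket (m - 1 + 1) n = qnum m q • ket m n := by
      rcases m with _ | m <;> simp [qnum_zero]
    rw [mul_smul, e]
    have k2 := congrArg (· • ket m n) key
    simpa only [add_smul, neg_smul, one_smul, mul_smul] using k2
  · congr 1
    field_simp
    ring
  · rcases m with _ | m
    · simp [qnum_zero]
    · congr 1
      simp
      field_simp
      ring
  · have hn := qnum_mul q hq n
    have key : -(q ^ m * (q ^ (m + n + 1))⁻¹ * qnum n q) =
        1 + -(q * (q * q ^ m * ((q ^ (m + (n + 1) + 1))⁻¹ * qnum (n + 1) q))) := by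
      rw [h1]
      field_simp
      ring_nf at hn ⊢
      linear_combination q ^ 2 * q ^ (m * 2) * q ^ n * hn
    have e : qnum n q • ket m (n - 1 + 1) = qnum n q • ket m n := by
      rcases n with _ | n <;> simp [qnum_zero]
    rw [mul_right_comm, mul_comm _ (q ^ m), mul_smul, e]
    have k2 := congrArg (· • ket m n) key
    simpa only [add_smul, neg_smul, one_smul, mul_smul] using k2

/-- `ε_{γδ} A⁺^{δ} A⁺^{γ} = 0` on the Fock space. -/
theorem oscillator_crea (q : ℂ) (hq : q ≠ 0) (m n : ℕ) :
    ∑ γ, ∑ δ, epsSpin q γ δ • crea q δ (crea q γ (ket m n)) = 0 := by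
  have hs := csqrt_mul_self q
  have hs0 : csqrt q ≠ 0 := fun h => hq (by rw [← hs, h, zero_mul])
  have hi : (csqrt q)⁻¹ = csqrt q * q⁻¹ := by
    rw [eq_mul_inv_iff_mul_eq₀ hq, inv_mul_eq_iff_eq_mul₀ hs0, hs]
  simp only [Fin.sum_univ_two, epsSpin, crea_zero_ket, crea_one_ket, smul_smul, map_smul,
    Matrix.cons_val_zero, Matrix.cons_val_one, zero_smul, zero_add, hi]
  rw [zero_mul, zero_smul, add_zero, ← add_smul,
    show -(csqrt q * q⁻¹) * q ^ (m + 1) + csqrt q * q ^ m = 0 by field_simp; ring, zero_smul]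

/-- `ε^{αβ} A_α A_β = 0` on the Fock space. -/
theorem oscillator_anni (q : ℂ) (hq : q ≠ 0) (m n : ℕ) :
    ∑ α, ∑ β, (-epsSpin q α β) • anni q α (anni q β (ket m n)) = 0 := by
  have hs := csqrt_mul_self q
  have hs0 : csqrt q ≠ 0 := fun h => hq (by rw [← hs, h, zero_mul])
  have hi : (csqrt q)⁻¹ = csqrt q * q⁻¹ := by
    rw [eq_mul_inv_iff_mul_eq₀ hq, inv_mul_eq_iff_eq_mul₀ hs0, hs]
  rcases m with _ | m <;> rcases n with _ | n <;>
    simp [Fin.sum_univ_two, epsSpin, anni_zero_ket, anni_one_ket, qnum_zero, smul_smul, hi]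
  rw [← neg_smul, ← add_smul]
  refine smul_eq_zero_of_left ?_ _
  field_simp
  ring

/-! ### The `q`-deformed fuzzy sphere -/

/-- `Ẑ_i = - A⁺^{α'} ε_{αα'} σ_i^{αβ} A_β`. -/
def Zhat (q : ℂ) (i : Fin 3) : Fock →ₗ[ℂ] Fock :=
  -∑ α, ∑ α', ∑ β, (epsSpin q α α' * sig q i α β) • (crea q α' ∘ₗ anni q β)

/-- The restriction of `Ẑ_i` to the `N`-particle space `F_N`, as a matrix in the basis
`|k, N - k⟩`, `k = 0, …, N`. -/
def Zmat (N : ℕ) (q : ℂ) (i : Fin 3) : Matrix (Fin (N + 1)) (Fin (N + 1)) ℂ :=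
  fun k l => Zhat q i (ket l (N - l)) ((k : ℕ), N - (k : ℕ))

/-- `S²_{q,N}`: the algebra of operators on `F_N` generated by the `Ẑ_i`, that is, by the
coordinates `x_i`, which are nonzero multiples of the `Ẑ_i`. -/
abbrev Sphere (N : ℕ) (q : ℂ) : Type :=
  Algebra.adjoin ℂ (Set.range (Zmat N q))

/-- `Ẑ_i` as an element of `S²_{q,N}`. -/
def Z (N : ℕ) (q : ℂ) (i : Fin 3) : Sphere N q :=
  ⟨Zmat N q i, Algebra.subset_adjoin ⟨i, rfl⟩⟩

/-- `√([N]_q [N+2]_q)`. -/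
def rootNN (N : ℕ) (q : ℂ) : ℂ := csqrt (qnum N q * qnum (N + 2) q)

/-- `Λ_N = r [2]_{q^{N+1}} / √([N]_q [N+2]_q)`. -/
def Lam (N : ℕ) (q : ℂ) (r : ℝ) : ℂ := r * qnum 2 (q ^ (N + 1)) / rootNN N q

/-- The coordinates `x_i = r q^{N+2} / √([2]_q C_N) Ẑ_i`, `C_N = [N]_q [N+2]_q / [2]_q²`;
here `√([2]_q C_N) = √([N]_q [N+2]_q) / √[2]_q`. -/
def x (N : ℕ) (q : ℂ) (r : ℝ) (i : Fin 3) : Sphere N q :=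
  (r * q ^ (N + 2) * csqrt (qnum 2 q) / rootNN N q) • Z N q i

/-! ### The map `j : U_q(su(2)) → S²_{q,N}` and the matrices `L⁺`, `S(L⁺)` -/

/-- `j(q^{-H}) = [2]_{q^{N+1}} / [2]_q + q^{N+2} (q - q⁻¹) / √[2]_q Ẑ_0`. -/
def jKinv (N : ℕ) (q : ℂ) : Sphere N q :=
  algebraMap ℂ _ (qnum 2 (q ^ (N + 1)) / qnum 2 q)
    + (q ^ (N + 2) * (q - q⁻¹) / csqrt (qnum 2 q)) • Z N q 1

/-- `j(q^{H})`. -/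
def jK (N : ℕ) (q : ℂ) : Sphere N q := Ring.inverse (jKinv N q)

/-- `j(X⁻ q^{-H/2}) = - q^{N+1} Ẑ_{-1}`. -/
def jF (N : ℕ) (q : ℂ) : Sphere N q := (-q ^ (N + 1)) • Z N q 2

/-- `j(q^{w H / 2})` for `w = 2, 0, -2`, the weights of the vector representation. -/
def jT (N : ℕ) (q : ℂ) : Fin 3 → Sphere N q := ![jK N q, 1, jKinv N q]

/-- `j(S(q^{w H / 2}))` for `w = 2, 0, -2`. -/
def jST (N : ℕ) (q : ℂ) : Fin 3 → Sphere N q := ![jKinv N q, 1, jK N q]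

/-- `j(S(X⁻ q^{-H/2}))`; by `S(X⁻) = - q X⁻` and `S(q^{-H/2}) = q^{H/2}` one has
`S(X⁻ q^{-H/2}) = q^{H/2} (- q X⁻) = - (X⁻ q^{-H/2}) q^{H}`. -/
def jSF (N : ℕ) (q : ℂ) : Sphere N q := -(jF N q * jK N q)

/-- The matrix `π^i_j(q^{H/2} X⁺)` in the vector representation
`X⁺ e_0 = √[2]_q e_1`, `X⁺ e_{-1} = √[2]_q e_0`, `H e_i = 2 i e_i`. -/
def piE (q : ℂ) : Matrix (Fin 3) (Fin 3) ℂ :=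
  csqrt (qnum 2 q) • !![0, q, 0; 0, 0, 1; 0, 0, 0]

/-- The coefficient `q^{n(n-1)/2} (q - q⁻¹)^n / [n]_q!` of the universal `R`-matrix
`R = q^{H ⊗ H / 2} ∑_n q^{n(n-1)/2} (q - q⁻¹)^n / [n]_q! (X⁻ q^{-H/2})^n ⊗ (q^{H/2} X⁺)^n`. -/
def Rcoeff (q : ℂ) (n : ℕ) : ℂ :=
  q ^ (n * (n - 1) / 2) * (q - q⁻¹) ^ n / ∏ k ∈ Finset.range n, qnum (k + 1) q

/-- `L⁺^i_j = R_1 π^i_j(R_2)`, as an element of `S²_{q,N}` via `j`. The terms of `R` with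
`n ≥ 3` vanish in the three-dimensional representation `π`. -/
def Lplus (N : ℕ) (q : ℂ) (i j : Fin 3) : Sphere N q :=
  ∑ n ∈ Finset.range 3, (Rcoeff q n * (piE q ^ n) i j) • (jT N q i * jF N q ^ n)

/-- `S(L⁺^i_j) = S(R_1) π^i_j(R_2)`, as an element of `S²_{q,N}` via `j`. -/
def SLplus (N : ℕ) (q : ℂ) (i j : Fin 3) : Sphere N q :=
  ∑ n ∈ Finset.range 3, (Rcoeff q n * (piE q ^ n) i j) • (jSF N q ^ n * jST N q i)

/-! ### The differential calculus -/

/-- The defining relations of the algebra of differential forms, on generators `f ∈ S²_{q,N}`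
(`Sum.inl f`) and `ξ_i` (`Sum.inr i`): those of the algebra `S²_{q,N}`, the braiding
`x_i ξ_j = R̂^{kl}_{ij} ξ_k x_l`, and `ξ_i ξ_j = - q² R̂^{kl}_{ij} ξ_k ξ_l`. -/
inductive FormRel (N : ℕ) (q : ℂ) (r : ℝ) :
    FreeAlgebra ℂ (Sphere N q ⊕ Fin 3) → FreeAlgebra ℂ (Sphere N q ⊕ Fin 3) → Prop
  | add (f h : Sphere N q) : FormRel N q r (FreeAlgebra.ι ℂ (Sum.inl (f + h)))
      (FreeAlgebra.ι ℂ (Sum.inl f) + FreeAlgebra.ι ℂ (Sum.inl h))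
  | mul (f h : Sphere N q) : FormRel N q r (FreeAlgebra.ι ℂ (Sum.inl (f * h)))
      (FreeAlgebra.ι ℂ (Sum.inl f) * FreeAlgebra.ι ℂ (Sum.inl h))
  | scalar (c : ℂ) : FormRel N q r (FreeAlgebra.ι ℂ (Sum.inl (algebraMap ℂ (Sphere N q) c)))
      (algebraMap ℂ _ c)
  | braid (i j : Fin 3) : FormRel N q r
      (FreeAlgebra.ι ℂ (Sum.inl (x N q r i)) * FreeAlgebra.ι ℂ (Sum.inr j))
      (∑ k, ∑ l, Rhat q k l i j •
        (FreeAlgebra.ι ℂ (Sum.inr k) * FreeAlgebra.ι ℂ (Sum.inl (x N q r l))))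
  | ext (i j : Fin 3) : FormRel N q r
      (FreeAlgebra.ι ℂ (Sum.inr i) * FreeAlgebra.ι ℂ (Sum.inr j))
      ((-q ^ 2) • ∑ k, ∑ l, Rhat q k l i j •
        (FreeAlgebra.ι ℂ (Sum.inr k) * FreeAlgebra.ι ℂ (Sum.inr l)))

/-- The algebra `Ω*_{q,N}` of differential forms. -/
abbrev Forms (N : ℕ) (q : ℂ) (r : ℝ) : Type := RingQuot (FormRel N q r)

/-- The function `f ∈ S²_{q,N}` as a form of degree zero. -/
def fn (N : ℕ) (q : ℂ) (r : ℝ) (f : Sphere N q) : Forms N q r :=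
  RingQuot.mkAlgHom ℂ (FormRel N q r) (FreeAlgebra.ι ℂ (Sum.inl f))

/-- The one-forms `ξ_i`. -/
def xi (N : ℕ) (q : ℂ) (r : ℝ) (i : Fin 3) : Forms N q r :=
  RingQuot.mkAlgHom ℂ (FormRel N q r) (FreeAlgebra.ι ℂ (Sum.inr i))

/-- `Ω^n_{q,N}`: the span of the elements `ξ_{i_1} ⋯ ξ_{i_n} f`. -/
def formsDeg (N : ℕ) (q : ℂ) (r : ℝ) (n : ℕ) : Submodule ℂ (Forms N q r) :=
  Submodule.span ℂ (Set.range fun p : (Fin n → Fin 3) × Sphere N q =>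
    (List.ofFn fun t => xi N q r (p.1 t)).prod * fn N q r p.2)

/-- `Θ = x_i ξ_j g^{ij}`. -/
def Theta (N : ℕ) (q : ℂ) (r : ℝ) : Forms N q r :=
  ∑ i, ∑ j, g q i j • (fn N q r (x N q r i) * xi N q r j)

/-- `*_H : Ω¹ → Ω²` is the left and right `S²_{q,N}`-module map with
`*_H ξ_i = - q⁻² Λ_N / [2]_{q²} ε_i^{jk} ξ_j ξ_k`. -/
structure IsHodgeStar (N : ℕ) (q : ℂ) (r : ℝ)
    (H : formsDeg N q r 1 →ₗ[ℂ] formsDeg N q r 2) : Prop where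
  left : ∀ (f : Sphere N q) (α β : formsDeg N q r 1),
    (β : Forms N q r) = fn N q r f * α → (H β : Forms N q r) = fn N q r f * H α
  right : ∀ (f : Sphere N q) (α β : formsDeg N q r 1),
    (β : Forms N q r) = α * fn N q r f → (H β : Forms N q r) = H α * fn N q r f
  map_xi : ∀ (i : Fin 3) (α : formsDeg N q r 1), (α : Forms N q r) = xi N q r i →
    (H α : Forms N q r) = (-((q ^ 2)⁻¹ * Lam N q r / qnum 2 (q ^ 2))) •
      ∑ j, ∑ k, eps q j k i • (xi N q r j * xi N q r k)

/-- `d : Ω⁰ → Ω¹`, `df = [Θ, f]`. -/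
def dZero (N : ℕ) (q : ℂ) (r : ℝ) (f : Sphere N q) : Forms N q r :=
  Theta N q r * fn N q r f - fn N q r f * Theta N q r

/-- `d : Ω¹ → Ω²`, `dα = [Θ, α]_+ - *_H α`. -/
def dOne (N : ℕ) (q : ℂ) (r : ℝ) (H : formsDeg N q r 1 →ₗ[ℂ] formsDeg N q r 2)
    (α : formsDeg N q r 1) : Forms N q r :=
  Theta N q r * α + α * Theta N q r - H α

/-- `θ^a = Λ_N S(L⁺^a_j) g^{jk} ξ_k`. -/
def theta (N : ℕ) (q : ℂ) (r : ℝ) (a : Fin 3) : Forms N q r :=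
  Lam N q r • ∑ j, ∑ k, g q j k • (fn N q r (SLplus N q a j) * xi N q r k)

/-- `λ_a = x_i L⁺^i_a / Λ_N`. -/
def lam (N : ℕ) (q : ℂ) (r : ℝ) (a : Fin 3) : Sphere N q :=
  (Lam N q r)⁻¹ • ∑ i, x N q r i * Lplus N q i a

end

end QFuzzy

namespace QFuzzy

section operators

open Matrix

/-! ### Scalars -/

/-! Everything rests on the matrix `N_{ja} = g_{jk} L⁺^k_a` of functions (`sphN`). The antipode
property makes `W_{ak} = S(L⁺^a_j) g^{jk}` its inverse, so the definition of the frame inverts to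
`Λ_N ξ_j = N_{ja} θ^a`. In the sphere `x_i N_{ja} = R̂^{kl}_{ij} N_{ka} x_l` (`x_mul_sphN`), which
has the form of the braiding of `x_i` with `ξ_j`. Hence `R̂` annihilates the array `N_{ka} (θ^a x_l
- x_l θ^a)`. Cancelling `R̂` and then `N` shows that `θ^a` commutes with the generators `x_l`, and
so with all functions (`theta_mul_x`, `theta_mul_fn`).

The remaining algebra of the frame follows by moving functions past `θ^a`. The RLL relation carries
the relations of the `ξ_i` to those of the `θ^a`, and contracting `x_i g^{ij} ξ_j` gives `Θ = λ_a
θ^a`. The relations of the `λ_a` are the radius and commutation relations of the sphere, dressed by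
`L⁺`. All identities in the sphere are reduced to `SphereRel`, a short list of relations of three
rescaled generators `D, F, G` and `K = q^H`, read off from explicit diagonal and ladder matrices on
`F_N`.

In degree two the relations put `θ^a θ^b` in the image of `P⁻`, so `θ^a θ^b = ε^{ba}_n η^n`.
Associativity then forces `η^n θ^c = g^{cn} V` for a single `V` (`frame_mul_mul`). Contracting with
the `λ_a` gives `Θ³` as a nonzero scalar times `V`, which yields the cubic formula.

No collapse occurs, because the calculus acts on an explicit free module with basis `1, θ^a, η^n, V`
(`modelHom`). Applying forms to the vacuum recovers their coefficients, so the `θ^a` are independent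
and `Θ³` is free. The Hodge star is then prescribed on the frame. Its values commute with functions,
so it is a bimodule map, and invariance of `ε` under `N` gives the required value on `ξ_i`. -/

lemma csqrt_ne_zero {z : ℂ} (hz : z ≠ 0) : csqrt z ≠ 0 :=
  fun h => hz (by rw [← csqrt_mul_self z, h, zero_mul])

lemma qnum_two (q : ℂ) : qnum 2 q = q + q⁻¹ := by
  simp [qnum, Finset.sum_range_succ]

lemma qnum_three (q : ℂ) : qnum 3 q = q ^ 2 + 1 + (q ^ 2)⁻¹ := by
  simp [qnum, Finset.sum_range_succ]

lemma sub_inv_mul_qnum {q : ℂ} (hq : q ≠ 0) (n : ℕ) :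
    (q - q⁻¹) * qnum n q = q ^ n - (q ^ n)⁻¹ := by
  have h := (qnum_succ q hq n).symm.trans (qnum_succ' q hq n)
  linear_combination h

lemma qnum_add {q : ℂ} (hq : q ≠ 0) (l m : ℕ) :
    qnum (l + m) q = q ^ m * qnum l q + (q ^ l)⁻¹ * qnum m q := by
  induction m with
  | zero => simp [qnum_zero]
  | succ m ih =>
    rw [← add_assoc, qnum_succ q hq, ih, qnum_succ q hq, pow_add q l m]
    field_simp
    ring

/-! ### Eigenvalue identities, to be used with `u = q^l`, `v = q^m`, `A = [l]_q`, `B = [m]_q`, `l +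
m = N`. -/

section ladder

variable {q u v A B w : ℂ}

/-- The eigenvalue identity behind the product of a lowering and a raising operator. -/
lemma lower_raise_scalar (hq : q ≠ 0) (hu : u ≠ 0) (hv : v ≠ 0) (hw : w ≠ 0) (hw2 : w = q + q⁻¹)
    (hA : (q - q⁻¹) * A = u - u⁻¹) (hB : (q - q⁻¹) * B = v - v⁻¹) :
    u * v⁻¹ * B * (q * A + u⁻¹) =
      q⁻¹ * ((v * A + u⁻¹ * B) * (q ^ 2 * (v * A + u⁻¹ * B) + w * (u * v)⁻¹) / w ^ 2)
        - ((q * u * v + (q * u * v)⁻¹) / w) * ((-q * u * B + q⁻¹ * v⁻¹ * A) / w)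
        - q * ((-q * u * B + q⁻¹ * v⁻¹ * A) / w) ^ 2 := by
  -- At `q = ±1` the hypotheses `hA`, `hB` say nothing about `A` and `B`, but they force `u, v =
  -- ±1`, and what remains is polynomial in `A` and `B`. Otherwise they determine `A` and `B`, and
  -- the identity is one of rational functions in `q, u, v`.
  by_cases h : q ^ 2 = 1
  · have h' : q⁻¹ = q := by field_simp; exact h.symm
    rw [h', sub_self, zero_mul] at hA hB
    have hu2 : u ^ 2 = 1 := by field_simp at hA; linear_combination -hA
    have hv2 : v ^ 2 = 1 := by field_simp at hB; linear_combination -hB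
    rcases sq_eq_one_iff.mp h with rfl | rfl <;> rcases sq_eq_one_iff.mp hu2 with rfl | rfl <;>
      rcases sq_eq_one_iff.mp hv2 with rfl | rfl <;> norm_num at hw2 <;> subst hw2 <;>
      norm_num <;> ring
  · have h' : q ^ 2 - 1 ≠ 0 := sub_ne_zero.2 h
    have hA' : A = q * (u^2-1) / (u * (q^2-1)) := by field_simp at hA ⊢; linear_combination hA
    have hB' : B = q * (v^2-1) / (v * (q^2-1)) := by field_simp at hB ⊢; linear_combination hB
    have hw3 : w = (q^2+1)/q := by rw [hw2]; field_simp
    have h3 : q^2+1 ≠ 0 := fun h3 => hw (by rw [hw3, h3, zero_div])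
    subst hA' hB' hw3
    field_simp
    ring

/-- The eigenvalue identity behind the product of a raising and a lowering operator. -/
lemma raise_lower_scalar (hq : q ≠ 0) (hu : u ≠ 0) (hv : v ≠ 0) (hw : w ≠ 0) (hw2 : w = q + q⁻¹)
    (hA : (q - q⁻¹) * A = u - u⁻¹) (hB : (q - q⁻¹) * B = v - v⁻¹) :
    u * v⁻¹ * (q * B + v⁻¹) * A =
      q * ((v * A + u⁻¹ * B) * (q ^ 2 * (v * A + u⁻¹ * B) + w * (u * v)⁻¹) / w ^ 2)
        + ((q * u * v + (q * u * v)⁻¹) / w) * ((-q * u * B + q⁻¹ * v⁻¹ * A) / w)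
        - q⁻¹ * ((-q * u * B + q⁻¹ * v⁻¹ * A) / w) ^ 2 := by
  by_cases h : q ^ 2 = 1
  · have h' : q⁻¹ = q := by field_simp; exact h.symm
    rw [h', sub_self, zero_mul] at hA hB
    have hu2 : u ^ 2 = 1 := by field_simp at hA; linear_combination -hA
    have hv2 : v ^ 2 = 1 := by field_simp at hB; linear_combination -hB
    rcases sq_eq_one_iff.mp h with rfl | rfl <;> rcases sq_eq_one_iff.mp hu2 with rfl | rfl <;>
      rcases sq_eq_one_iff.mp hv2 with rfl | rfl <;> norm_num at hw2 <;> subst hw2 <;>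
      norm_num <;> ring
  · have h' : q ^ 2 - 1 ≠ 0 := sub_ne_zero.2 h
    have hA' : A = q * (u^2-1) / (u * (q^2-1)) := by field_simp at hA ⊢; linear_combination hA
    have hB' : B = q * (v^2-1) / (v * (q^2-1)) := by field_simp at hB ⊢; linear_combination hB
    have hw3 : w = (q^2+1)/q := by rw [hw2]; field_simp
    have h3 : q^2+1 ≠ 0 := fun h3 => hw (by rw [hw3, h3, zero_div])
    subst hA' hB' hw3
    field_simp
    ring

end ladder

/-! ### The operators `Ẑ_i` on Fock space -/

lemma zhat_zero_ket (q : ℂ) (l m : ℕ) : Zhat q 0 (ket l m) =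
    (-(csqrt q)⁻¹ * ((q ^ (l + 2 * m + 3))⁻¹ * qnum l q) * q ^ (l - 1)) •
      ket (l - 1) (m + 1) := by
  simp [Zhat, Fin.sum_univ_two, epsSpin, sig, anni_zero_ket, crea_one_ket, smul_smul, mul_assoc]

lemma zhat_two_ket (q : ℂ) (l m : ℕ) : Zhat q 2 (ket l m) =
    (csqrt q * ((q ^ (l + m + 1))⁻¹ * qnum m q)) • ket (l + 1) (m - 1) := by
  simp [Zhat, Fin.sum_univ_two, epsSpin, sig, anni_one_ket, crea_zero_ket, smul_smul]

lemma zhat_one_ket (q : ℂ) (hq : q ≠ 0) (l m : ℕ) : Zhat q 1 (ket l m) =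
    ((csqrt (qnum 2 q))⁻¹ * ((q ^ (l + 2 * m + 3))⁻¹ * qnum l q - (q ^ (m + 1))⁻¹ * qnum m q)) •
      ket l m := by
  have hs0 := csqrt_ne_zero hq
  -- The natural subtraction truncates only at `l = 0`, where the coefficient `[0]_q` vanishes.
  have e1 : qnum l q • ket (l - 1 + 1) m = qnum l q • ket l m := by
    rcases l with _ | m <;> simp [qnum_zero]
  have e2 : qnum m q • ket l (m - 1 + 1) = qnum m q • ket l m := by
    rcases m with _ | m <;> simp [qnum_zero]
  simp only [Zhat, Fin.sum_univ_two, epsSpin, sig]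
  simp [anni_one_ket, crea_zero_ket, crea_one_ket, anni_zero_ket, smul_smul]
  rw [← mul_assoc, mul_smul, e1, mul_right_comm _ (qnum m q), ← mul_assoc,
    mul_smul _ (qnum m q), e2]
  simp only [smul_smul, ← neg_smul, ← add_smul]
  congr 1
  field_simp
  ring

/-! ### The matrices of the generators -/

lemma ket_apply (l m l' m' : ℕ) : ket l m (l', m') = if l = l' ∧ m = m' then 1 else 0 := by
  simp [ket, Finsupp.single_apply]

variable (N : ℕ) (q : ℂ)

/-- The eigenvalues of the rescaled `Ẑ_0`. -/
noncomputable def dVal (l : ℕ) : ℂ :=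
  (-q * q ^ l * qnum (N - l) q + q⁻¹ * (q ^ (N - l))⁻¹ * qnum l q) / qnum 2 q

variable {N q}

lemma zmat_zero_apply (k l : Fin (N + 1)) : Zmat N q 0 k l =
    if (k : ℕ) + 1 = l then
      -(csqrt q)⁻¹ * ((q ^ (l + 2 * (N - l) + 3))⁻¹ * qnum l q) * q ^ (k : ℕ) else 0 := by
  rw [Zmat, zhat_zero_ket]
  simp only [Finsupp.smul_apply, ket_apply, smul_eq_mul, mul_ite, mul_one, mul_zero]
  rcases Nat.eq_zero_or_pos (l : ℕ) with h | h
  · rw [if_neg (by omega : ¬ (k : ℕ) + 1 = l)]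
    simp [h, qnum_zero]
  · by_cases hk : (k : ℕ) + 1 = l
    · rw [if_pos hk, if_pos (by omega), show (l : ℕ) - 1 = k by omega]
    · rw [if_neg hk, if_neg (by omega)]

lemma zmat_two_apply (k l : Fin (N + 1)) : Zmat N q 2 k l =
    if (k : ℕ) = l + 1 then csqrt q * ((q ^ (N + 1))⁻¹ * qnum (N - l) q) else 0 := by
  rw [Zmat, zhat_two_ket]
  simp only [Finsupp.smul_apply, ket_apply, smul_eq_mul, mul_ite, mul_one, mul_zero]
  rcases Nat.eq_zero_or_pos (N - l : ℕ) with h | h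
  · rw [h]
    simp [qnum_zero]
  · by_cases hk : (k : ℕ) = l + 1
    · rw [if_pos hk, if_pos (by omega), show (l : ℕ) + (N - l) = N by omega]
    · rw [if_neg hk, if_neg (by omega)]

lemma smul_zmat_one (hq : q ≠ 0) (h2 : qnum 2 q ≠ 0) :
    (q ^ (N + 2) / csqrt (qnum 2 q)) • Zmat N q 1 = diagonal fun l : Fin (N + 1) => dVal N q l := by
  have hw := csqrt_mul_self (qnum 2 q)
  have hw0 := csqrt_ne_zero h2
  ext k l
  have hl : (l : ℕ) + (N - l) = N := by omega
  obtain ⟨m, hm⟩ : ∃ m, m = N - (l : ℕ) := ⟨_, rfl⟩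
  rw [Matrix.smul_apply, Zmat, zhat_one_ket q hq, diagonal_apply, dVal]
  simp only [Finsupp.smul_apply, ket_apply, smul_eq_mul, mul_ite, mul_one, mul_zero]
  rw [← hm] at hl ⊢
  by_cases hk : k = l
  · subst hk
    rw [if_pos ⟨rfl, hm⟩, if_pos rfl, ← hm,
      show q ^ (N + 2) = q ^ ((k : ℕ) + m) * q ^ 2 by rw [hl, pow_add]]
    generalize csqrt (qnum 2 q) = w at hw hw0
    rw [← hw]
    field_simp
    ring
  · rw [if_neg (fun h => hk (Fin.ext h.1.symm)), if_neg hk]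

lemma zmat_zero_mul_two (hq : q ≠ 0) : Zmat N q 0 * Zmat N q 2 = diagonal fun l : Fin (N + 1) =>
    -(q ^ (N + 1))⁻¹ * (q ^ (2 * (N - l) + 2))⁻¹ * qnum (N - l) q * qnum (l + 1) q := by
  have hs0 := csqrt_ne_zero hq
  ext k l
  rw [mul_apply, diagonal_apply]
  simp only [zmat_zero_apply, zmat_two_apply]
  by_cases hl : (l : ℕ) < N
  · rw [Finset.sum_eq_single ⟨l + 1, by omega⟩]
    · by_cases hk : k = l
      · subst hk
        obtain ⟨m, hm⟩ : ∃ m, m = N - ((k : ℕ) + 1) := ⟨_, rfl⟩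
        have hm' : N - (k : ℕ) = m + 1 := by omega
        simp only [if_true, ← hm, hm']
        field_simp
        ring
      · rw [if_neg hk, if_neg (fun h => hk (Fin.ext (by simpa using h))), zero_mul]
    · intro j _ hj
      rw [if_neg (fun h : (j : ℕ) = l + 1 => hj (Fin.ext h)), mul_zero]
    · simp
  -- At `l = N` the intermediate index `N + 1` lies outside the matrix, and the closed formula
  -- vanishes too because `[N - l]_q = [0]_q`.
  · rw [Finset.sum_eq_zero]
    · split_ifs with h
      · simp [h, show N - (l : ℕ) = 0 by omega, qnum_zero]
      · rfl
    · intro j _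
      rw [if_neg (by omega : ¬ (j : ℕ) = l + 1), mul_zero]

lemma zmat_two_mul_zero (hq : q ≠ 0) : Zmat N q 2 * Zmat N q 0 = diagonal fun l : Fin (N + 1) =>
    -(q ^ (N + 1))⁻¹ * (q ^ (2 * (N - l) + 4))⁻¹ * qnum (N - l + 1) q * qnum l q := by
  have hs0 := csqrt_ne_zero hq
  ext k l
  rw [mul_apply, diagonal_apply]
  simp only [zmat_zero_apply, zmat_two_apply]
  obtain ⟨l, hlN⟩ := l
  rcases l with _ | l
  · rw [Finset.sum_eq_zero]
    · split_ifs with h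
      · simp [h, qnum_zero]
      · rfl
    · intro j _
      simp
  · rw [Finset.sum_eq_single ⟨l, by omega⟩]
    · by_cases hk : k = ⟨l + 1, hlN⟩
      · subst hk
        obtain ⟨m, hm⟩ : ∃ m, m = N - (l + 1) := ⟨_, rfl⟩
        have hm' : N - l = m + 1 := by omega
        simp only [if_true, ← hm, hm']
        field_simp
        ring
      · rw [if_neg hk, if_neg (fun h => hk (Fin.ext h)), zero_mul]
    · intro j _ hj
      rw [if_neg (fun h => hj (Fin.ext (by simpa using h)) : ¬ (j : ℕ) + 1 = l + 1), mul_zero]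
    · simp

/-- The eigenvalues of `q^{-H}` are `sphA + (q - q⁻¹) d_l = q^{2l - N}`, which a unit step in `l`
multiplies by `q²`. Divided by `q - q⁻¹` this is an affine recursion that also survives at `q = ±1`.
It produces the commutation relations of `sphD` with the ladder operators. -/
lemma dVal_succ (hq : q ≠ 0) (h2 : qnum 2 q ≠ 0) {l : ℕ} (hl : l < N) :
    dVal N q (l + 1) = q ^ 2 * dVal N q l + qnum 2 (q ^ (N + 1)) / qnum 2 q * q := by
  obtain ⟨m, rfl⟩ : ∃ m, N = l + 1 + m := ⟨N - (l + 1), by omega⟩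
  have e1 : l + 1 + m - (l + 1) = m := by omega
  have e2 : l + 1 + m - l = m + 1 := by omega
  have hA := sub_inv_mul_qnum hq l
  have hB := sub_inv_mul_qnum hq m
  simp only [dVal, e1, e2, qnum_succ q hq l, qnum_succ q hq m]
  rw [qnum_two (q ^ _)]
  field_simp at hA hB ⊢
  ring_nf at hA hB ⊢
  linear_combination q ^ 6 * q ^ (l * 3) * q ^ (m * 2) * hB

variable (N q)

/-- `q^{N+2} Ẑ_0 / √[2]_q`. -/
noncomputable def sphD : Sphere N q := (q ^ (N + 2) / csqrt (qnum 2 q)) • Z N q 1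

/-- `√[2]_q X⁻ q^{-H/2}`. -/
noncomputable def sphF : Sphere N q := csqrt (qnum 2 q) • jF N q

/-- `q^{N+2} √[2]_q Ẑ_1`. -/
noncomputable def sphG : Sphere N q := (q ^ (N + 2) * csqrt (qnum 2 q)) • Z N q 0

/-- `[2]_{q^{N+1}} / [2]_q`. -/
noncomputable def sphA : ℂ := qnum 2 (q ^ (N + 1)) / qnum 2 q

/-- `[N]_q [N+2]_q / [2]_q²`. -/
noncomputable def sphC : ℂ := qnum N q * qnum (N + 2) q / qnum 2 q ^ 2

variable {N q}

lemma coe_sphD (hq : q ≠ 0) (h2 : qnum 2 q ≠ 0) :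
    (sphD N q : Matrix (Fin (N + 1)) (Fin (N + 1)) ℂ) =
      diagonal fun l : Fin (N + 1) => dVal N q l :=
  smul_zmat_one hq h2

lemma coe_sphF : (sphF N q : Matrix (Fin (N + 1)) (Fin (N + 1)) ℂ) =
    (-(q ^ (N + 1) * csqrt (qnum 2 q))) • Zmat N q 2 := by
  simp [sphF, jF, Z, smul_smul, mul_comm]

lemma coe_sphG : (sphG N q : Matrix (Fin (N + 1)) (Fin (N + 1)) ℂ) =
    (q ^ (N + 2) * csqrt (qnum 2 q)) • Zmat N q 0 := by
  simp [sphG, Z]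

lemma diagonal_mul_zmat_two (hq : q ≠ 0) (h2 : qnum 2 q ≠ 0) :
    (diagonal fun l : Fin (N + 1) => dVal N q l) * Zmat N q 2 =
      q ^ 2 • (Zmat N q 2 * diagonal fun l : Fin (N + 1) => dVal N q l)
        + (sphA N q * q) • Zmat N q 2 := by
  ext k l
  simp only [diagonal_mul, mul_diagonal, Matrix.add_apply, Matrix.smul_apply, smul_eq_mul,
    zmat_two_apply]
  split_ifs with h
  · rw [h, dVal_succ hq h2 (by omega), sphA]
    ring
  · simp

lemma diagonal_mul_zmat_zero (hq : q ≠ 0) (h2 : qnum 2 q ≠ 0) :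
    Zmat N q 0 * (diagonal fun l : Fin (N + 1) => dVal N q l) =
      q ^ 2 • ((diagonal fun l : Fin (N + 1) => dVal N q l) * Zmat N q 0)
        + (sphA N q * q) • Zmat N q 0 := by
  ext k l
  simp only [diagonal_mul, mul_diagonal, Matrix.add_apply, Matrix.smul_apply, smul_eq_mul,
    zmat_zero_apply]
  split_ifs with h
  · rw [← h, dVal_succ hq h2 (by omega), sphA]
    ring
  · simp

lemma sphD_mul_sphF (hq : q ≠ 0) (h2 : qnum 2 q ≠ 0) :
    sphD N q * sphF N q = q ^ 2 • (sphF N q * sphD N q) + (sphA N q * q) • sphF N q := by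
  apply Subtype.ext
  simp only [MulMemClass.coe_mul, AddMemClass.coe_add, SetLike.val_smul, coe_sphD hq h2, coe_sphF,
    mul_smul_comm,
    smul_mul_assoc, diagonal_mul_zmat_two hq h2, smul_add]
  module

lemma sphG_mul_sphD (hq : q ≠ 0) (h2 : qnum 2 q ≠ 0) :
    sphG N q * sphD N q = q ^ 2 • (sphD N q * sphG N q) + (sphA N q * q) • sphG N q := by
  apply Subtype.ext
  simp only [MulMemClass.coe_mul, AddMemClass.coe_add, SetLike.val_smul, coe_sphD hq h2, coe_sphG,
    mul_smul_comm,
    smul_mul_assoc, diagonal_mul_zmat_zero hq h2, smul_add]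
  module

lemma sphC_add (hq : q ≠ 0) (l m : ℕ) : sphC (l + m) q =
    (q ^ m * qnum l q + (q ^ l)⁻¹ * qnum m q) * (q ^ 2 * (q ^ m * qnum l q + (q ^ l)⁻¹ * qnum m q)
      + qnum 2 q * (q ^ l * q ^ m)⁻¹) / qnum 2 q ^ 2 := by
  rw [sphC, qnum_add hq l m, qnum_add hq (l + m) 2, qnum_add hq l m, pow_add q l m,
    mul_comm (qnum 2 q)]

lemma sphA_add (l m : ℕ) :
    sphA (l + m) q = (q * q ^ l * q ^ m + (q * q ^ l * q ^ m)⁻¹) / qnum 2 q := by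
  rw [sphA, qnum_two (q ^ _), show q ^ (l + m + 1) = q * q ^ l * q ^ m by ring]

lemma dVal_add (l m : ℕ) : dVal (l + m) q l =
    (-q * q ^ l * qnum m q + q⁻¹ * (q ^ m)⁻¹ * qnum l q) / qnum 2 q := by
  rw [dVal, Nat.add_sub_cancel_left]

/-- Lowering after raising is diagonal, and `lower_raise_scalar` expresses its eigenvalues as a
quadratic polynomial in those of `sphD`. With the opposite product below, this encodes both the
radius relation and the commutator of the ladder operators. -/
lemma sphG_mul_sphF (hq : q ≠ 0) (h2 : qnum 2 q ≠ 0) :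
    sphG N q * sphF N q = qnum 2 q • ((q⁻¹ * sphC N q) • 1 - sphA N q • sphD N q
      - q • (sphD N q * sphD N q)) := by
  apply Subtype.ext
  simp only [MulMemClass.coe_mul, AddSubgroupClass.coe_sub, SetLike.val_smul, OneMemClass.coe_one,
    coe_sphD hq h2, coe_sphG, coe_sphF,
    mul_smul_comm,
    smul_mul_assoc, zmat_zero_mul_two hq, diagonal_mul_diagonal, smul_smul]
  have hw := csqrt_mul_self (qnum 2 q)
  ext k l
  simp only [Matrix.smul_apply, Matrix.sub_apply, diagonal_apply, one_apply]
  split_ifs with h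
  · obtain ⟨m, hm⟩ : ∃ m, m = N - (l : ℕ) := ⟨_, rfl⟩
    obtain ⟨l, hl⟩ := l
    simp only at hm
    obtain rfl : N = l + m := by omega
    subst h
    have key := lower_raise_scalar hq (pow_ne_zero l hq) (pow_ne_zero m hq) h2 (qnum_two q)
      (sub_inv_mul_qnum hq l) (sub_inv_mul_qnum hq m)
    rw [← sphC_add hq, ← sphA_add, ← dVal_add, ← qnum_succ q hq] at key
    simp only [smul_eq_mul, mul_one, ← hm]
    rw [← sq, ← key, show ∀ a b c : ℂ, -(a * c) * (b * c) = -(a * b * (c * c)) by intros; ring, hw]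
    field_simp
    ring
  · simp

lemma sphF_mul_sphG (hq : q ≠ 0) (h2 : qnum 2 q ≠ 0) :
    sphF N q * sphG N q = (qnum 2 q * (q ^ 2)⁻¹) • ((q * sphC N q) • 1 + sphA N q • sphD N q
      - q⁻¹ • (sphD N q * sphD N q)) := by
  apply Subtype.ext
  simp only [MulMemClass.coe_mul, AddSubgroupClass.coe_sub, AddMemClass.coe_add, SetLike.val_smul,
    OneMemClass.coe_one, coe_sphD hq h2, coe_sphG, coe_sphF,
    mul_smul_comm,
    smul_mul_assoc, zmat_two_mul_zero hq, diagonal_mul_diagonal, smul_smul]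
  have hw := csqrt_mul_self (qnum 2 q)
  ext k l
  simp only [Matrix.smul_apply, Matrix.sub_apply, Matrix.add_apply, diagonal_apply, one_apply]
  split_ifs with h
  · obtain ⟨m, hm⟩ : ∃ m, m = N - (l : ℕ) := ⟨_, rfl⟩
    obtain ⟨l, hl⟩ := l
    simp only at hm
    obtain rfl : N = l + m := by omega
    subst h
    have key := raise_lower_scalar hq (pow_ne_zero l hq) (pow_ne_zero m hq) h2 (qnum_two q)
      (sub_inv_mul_qnum hq l) (sub_inv_mul_qnum hq m)
    rw [← sphC_add hq, ← sphA_add, ← dVal_add, ← qnum_succ q hq] at key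
    simp only [smul_eq_mul, mul_one, ← hm]
    rw [← sq, ← key, show ∀ a b c : ℂ, (a * c) * -(b * c) = -(a * b * (c * c)) by intros; ring, hw]
    field_simp
    ring
  · simp

/-! ### Invertibility of `q^{-H}` -/

lemma jKinv_eq : jKinv N q = algebraMap ℂ _ (sphA N q) + (q - q⁻¹) • sphD N q := by
  rw [jKinv, sphA, sphD, smul_smul]
  congr 2
  ring

lemma sphA_add_dVal (hq : q ≠ 0) (h2 : qnum 2 q ≠ 0) (l m : ℕ) :
    sphA (l + m) q + (q - q⁻¹) * dVal (l + m) q l = q ^ l * (q ^ m)⁻¹ := by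
  have hA := sub_inv_mul_qnum hq l
  have hB := sub_inv_mul_qnum hq m
  have e : (q - q⁻¹) * dVal (l + m) q l = (-q * q ^ l * ((q - q⁻¹) * qnum m q)
      + q⁻¹ * (q ^ m)⁻¹ * ((q - q⁻¹) * qnum l q)) / qnum 2 q := by
    rw [dVal_add]; ring
  rw [e, hA, hB, sphA_add, ← add_div, div_eq_iff h2, qnum_two]
  field_simp
  ring

/-- The diagonal entries `q^{2l - N}` are nonzero, so left multiplication by `q^{-H}` is injective
on the sphere. The sphere is finite-dimensional, so this map is also surjective, and the inverse
lies in the subalgebra and not merely among all matrices. -/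
lemma isUnit_jKinv (hq : q ≠ 0) (h2 : qnum 2 q ≠ 0) : IsUnit (jKinv N q) := by
  have hdiag : (jKinv N q : Matrix (Fin (N + 1)) (Fin (N + 1)) ℂ) =
      diagonal fun l : Fin (N + 1) => q ^ (l : ℕ) * (q ^ (N - l))⁻¹ := by
    rw [jKinv_eq, AddMemClass.coe_add, SetLike.val_smul, coe_sphD hq h2]
    ext k l
    by_cases h : k = l
    · subst h
      have := sphA_add_dVal hq h2 k (N - k)
      rw [show (k : ℕ) + (N - k) = N by omega] at this
      simpa [algebraMap_matrix_apply] using this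
    · simp [h, algebraMap_matrix_apply]
  have hinj : Function.Injective (LinearMap.mulLeft ℂ (jKinv N q)) := by
    rw [← LinearMap.ker_eq_bot, LinearMap.ker_eq_bot']
    intro f hf
    have hf' := congrArg (Subtype.val) hf
    simp only [LinearMap.mulLeft_apply, MulMemClass.coe_mul, hdiag, ZeroMemClass.coe_zero] at hf'
    apply Subtype.ext
    ext k l
    have := congrFun (congrFun hf' k) l
    rw [diagonal_mul] at this
    simpa [hq] using this
  obtain ⟨K, hK⟩ := LinearMap.injective_iff_surjective.1 hinj 1
  rw [LinearMap.mulLeft_apply] at hK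
  exact IsUnit.of_mul_eq_one K hK

end operators

/-- Substituting `P⁺ = 1 - P⁻ - P⁰`, the denominators cancel because `q² + q⁻² = [2]_{q²}` and `q⁻⁴
- q² = (q⁻² - 1) [3]_q`. Identities for `R̂` thereby split into an `ε`-part and a `g`-part. -/
lemma Rhat_eq {q : ℂ} (hq : q ≠ 0) (h3 : qnum 3 q ≠ 0) (h4 : qnum 2 (q ^ 2) ≠ 0)
    (k l i j : Fin 3) : Rhat q k l i j = q ^ 2 * (if k = i ∧ l = j then 1 else 0)
      - ∑ n, eps q k l n * eps q i j n + ((q ^ 2)⁻¹ - 1) * (g q k l * g q i j) := by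
  have e3 : (q ^ 4)⁻¹ - q ^ 2 = ((q ^ 2)⁻¹ - 1) * qnum 3 q := by
    rw [qnum_three]; field_simp; ring
  have e4 : q ^ 2 + (q ^ 2)⁻¹ = qnum 2 (q ^ 2) := (qnum_two _).symm
  have h : Rhat q k l i j = q ^ 2 * (if k = i ∧ l = j then 1 else 0)
      - (q ^ 2 + (q ^ 2)⁻¹) * projMinus q k l i j + ((q ^ 4)⁻¹ - q ^ 2) * projZero q k l i j := by
    rw [Rhat, projPlus]; ring
  rw [h, e3, e4, projMinus, projZero, mul_div_cancel₀ _ h4]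
  field_simp

/-! ### The Borel subalgebra and its matrices `L⁺`, `S(L⁺)`, `g L⁺`. -/

section abstract_relations

variable {A : Type*} [Ring A] [Algebra ℂ A]

/-- The matrix `L⁺` in terms of `q^{±H}` and `√[2]_q X⁻ q^{-H/2}`. -/
noncomputable def lMat (q : ℂ) (K K' F : A) : Fin 3 → Fin 3 → A :=
  ![![K, ((q - q⁻¹) * q) • (K * F), (q ^ 2 * (q - q⁻¹) ^ 2 / qnum 2 q) • (K * (F * F))],
    ![0, 1, (q - q⁻¹) • F], ![0, 0, K']]

/-- The antipode of `lMat`. -/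
noncomputable def slMat (q : ℂ) (K K' F : A) : Fin 3 → Fin 3 → A :=
  ![![K', (-((q - q⁻¹) * q)) • F, (q ^ 2 * (q - q⁻¹) ^ 2 / qnum 2 q) • (F * K * F)],
    ![0, 1, (-(q - q⁻¹)) • (F * K)], ![0, 0, K]]

/-- `g_{jk} L^k_a`. -/
noncomputable def nMat (q : ℂ) (K K' F : A) : Fin 3 → Fin 3 → A :=
  ![![0, 0, (-q⁻¹) • K'], ![0, 1, (q - q⁻¹) • F],
    ![(-q) • K, (-((q - q⁻¹) * q ^ 2)) • (K * F),
      (-(q ^ 3 * (q - q⁻¹) ^ 2 / qnum 2 q)) • (K * (F * F))]]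

/-- The relations of `q^{±H}` and `√[2]_q X⁻ q^{-H/2}`. -/
structure BorelRel (q : ℂ) (K K' F : A) : Prop where
  left_inv : K' * K = 1
  right_inv : K * K' = 1
  comm : F * K' = (q ^ 2)⁻¹ • (K' * F)

namespace BorelRel

variable {q : ℂ} {K K' F : A} (h : BorelRel q K K' F) (hq : q ≠ 0)
include h

lemma left_inv_assoc (x : A) : K' * (K * x) = x := by rw [← mul_assoc, h.left_inv, one_mul]

lemma right_inv_assoc (x : A) : K * (K' * x) = x := by rw [← mul_assoc, h.right_inv, one_mul]

lemma comm_assoc (x : A) : F * (K' * x) = (q ^ 2)⁻¹ • (K' * (F * x)) := by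
  rw [← mul_assoc, h.comm, smul_mul_assoc, mul_assoc]

include hq

lemma comm' : F * K = q ^ 2 • (K * F) := by
  have h1 : K * (F * K') * K = (q ^ 2)⁻¹ • (F * K) := by
    rw [h.comm, mul_smul_comm, smul_mul_assoc, h.right_inv_assoc]
  rw [mul_assoc, mul_assoc, h.left_inv, mul_one] at h1
  rw [h1, smul_smul, mul_inv_cancel₀ (pow_ne_zero 2 hq), one_smul]

lemma comm'_assoc (x : A) : F * (K * x) = q ^ 2 • (K * (F * x)) := by
  rw [← mul_assoc, h.comm' hq, smul_mul_assoc, mul_assoc]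

lemma lMat_mul_slMat (h3 : q ^ 2 + 1 ≠ 0) (i j : Fin 3) :
    ∑ k, lMat q K K' F i k * slMat q K K' F k j = if i = j then 1 else 0 := by
  have hw : qnum 2 q = (q ^ 2 + 1) / q := by rw [qnum_two]; field_simp
  fin_cases i <;> fin_cases j <;>
    simp [Fin.sum_univ_three, lMat, slMat, hw, smul_smul, mul_assoc, h.left_inv, h.right_inv,
      h.comm' hq, h.comm'_assoc hq]
  all_goals (match_scalars; field_simp; ring)

lemma slMat_mul_lMat (h3 : q ^ 2 + 1 ≠ 0) (i j : Fin 3) :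
    ∑ k, slMat q K K' F i k * lMat q K K' F k j = if i = j then 1 else 0 := by
  have hw : qnum 2 q = (q ^ 2 + 1) / q := by rw [qnum_two]; field_simp
  fin_cases i <;> fin_cases j <;>
    simp [Fin.sum_univ_three, lMat, slMat, hw, smul_smul, mul_assoc, h.left_inv, h.right_inv,
      h.left_inv_assoc, h.right_inv_assoc, h.comm, h.comm_assoc, h.comm' hq]
  all_goals (match_scalars; field_simp; ring)

/-- Invariance of `ε` under `g L⁺`, with the frame indices in reversed order. Together with the next
three identities, which contract `ε` and `g` on either side, it gives the RLL relation through
`Rhat_eq`. -/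
lemma eps_nMat_nMat (h3 : q ^ 2 + 1 ≠ 0) (i a b : Fin 3) :
    ∑ j, ∑ k, eps q j k i • (nMat q K K' F j a * nMat q K K' F k b) =
      ∑ m, eps q b a m • nMat q K K' F i m := by
  have hw : qnum 2 q = (q ^ 2 + 1) / q := by rw [qnum_two]; field_simp
  fin_cases i <;> fin_cases a <;> fin_cases b <;>
    simp [Fin.sum_univ_three, nMat, eps, hw, smul_smul, mul_assoc,
      h.left_inv, h.right_inv, h.left_inv_assoc, h.right_inv_assoc, h.comm, h.comm_assoc,
      h.comm' hq, h.comm'_assoc hq]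
  all_goals (match_scalars; field_simp <;> ring)

lemma nMat_nMat_eps (h3 : q ^ 2 + 1 ≠ 0) (i j m : Fin 3) :
    ∑ c, ∑ d, eps q d c m • (nMat q K K' F i c * nMat q K K' F j d) =
      ∑ k, eps q i j k • nMat q K K' F k m := by
  have hw : qnum 2 q = (q ^ 2 + 1) / q := by rw [qnum_two]; field_simp
  fin_cases i <;> fin_cases j <;> fin_cases m <;>
    simp [Fin.sum_univ_three, nMat, eps, hw, smul_smul, mul_assoc,
      h.left_inv, h.right_inv, h.left_inv_assoc, h.right_inv_assoc, h.comm, h.comm_assoc,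
      h.comm' hq, h.comm'_assoc hq]
  all_goals (match_scalars; field_simp <;> ring)

lemma g_nMat_nMat (h3 : q ^ 2 + 1 ≠ 0) (a b : Fin 3) :
    ∑ i, ∑ j, g q i j • (nMat q K K' F i a * nMat q K K' F j b) = algebraMap ℂ A (g q b a) := by
  have hw : qnum 2 q = (q ^ 2 + 1) / q := by rw [qnum_two]; field_simp
  fin_cases a <;> fin_cases b <;>
    simp [Fin.sum_univ_three, nMat, g, Algebra.algebraMap_eq_smul_one, hw, smul_smul, mul_assoc,
      h.left_inv, h.right_inv, h.left_inv_assoc, h.right_inv_assoc, h.comm, h.comm_assoc,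
      h.comm' hq, h.comm'_assoc hq]
  all_goals (match_scalars; field_simp <;> ring)

lemma nMat_nMat_g (h3 : q ^ 2 + 1 ≠ 0) (i j : Fin 3) :
    ∑ a, ∑ b, g q b a • (nMat q K K' F i a * nMat q K K' F j b) = algebraMap ℂ A (g q i j) := by
  have hw : qnum 2 q = (q ^ 2 + 1) / q := by rw [qnum_two]; field_simp
  fin_cases i <;> fin_cases j <;>
    simp [Fin.sum_univ_three, nMat, g, Algebra.algebraMap_eq_smul_one, hw, smul_smul, mul_assoc,
      h.left_inv, h.right_inv, h.left_inv_assoc, h.right_inv_assoc, h.comm, h.comm_assoc,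
      h.comm' hq, h.comm'_assoc hq]
  all_goals (match_scalars; field_simp <;> ring)

omit h in
lemma nMat_eq (j a : Fin 3) : nMat q K K' F j a = ∑ k, g q j k • lMat q K K' F k a := by
  fin_cases j <;> fin_cases a <;>
    simp [Fin.sum_univ_three, nMat, lMat, g, smul_smul]
  all_goals (match_scalars; field_simp)

end BorelRel
end abstract_relations

/-! ### The sphere by generators and relations, and its braiding with `L⁺`. -/

section abstract_relations

set_option linter.unusedSimpArgs false
set_option linter.unnecessarySeqFocus false

variable {A : Type*} [Ring A] [Algebra ℂ A]

/-- The relations of the rescaled generators of the `q`-deformed fuzzy sphere. -/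
structure SphereRel (q a c : ℂ) (K D F G : A) : Prop where
  left_inv : (algebraMap ℂ A a + (q - q⁻¹) • D) * K = 1
  right_inv : K * (algebraMap ℂ A a + (q - q⁻¹) • D) = 1
  D_mul_F : D * F = q ^ 2 • (F * D) + (a * q) • F
  G_mul_D : G * D = q ^ 2 • (D * G) + (a * q) • G
  G_mul_F : G * F = qnum 2 q • ((q⁻¹ * c) • 1 - a • D - q • (D * D))
  F_mul_G : F * G = (qnum 2 q * (q ^ 2)⁻¹) • ((q * c) • 1 + a • D - q⁻¹ • (D * D))

/-- The rescaled coordinates. -/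
noncomputable def yVec (q : ℂ) (D F G : A) : Fin 3 → A := ![G, qnum 2 q • D, (-q) • F]

/-- The right hand side of the braiding relation, with `R̂` written out. -/
noncomputable def braidSum (q : ℂ) (y : Fin 3 → A) (n : Fin 3 → Fin 3 → A) (i j b : Fin 3) : A :=
  ∑ k, ∑ l, (q ^ 2 * (if k = i ∧ l = j then 1 else 0) - ∑ n, eps q k l n * eps q i j n
    + ((q ^ 2)⁻¹ - 1) * (g q k l * g q i j)) • (n k b * y l)

namespace SphereRel

variable {q a c : ℂ} {K D F G : A} (h : SphereRel q a c K D F G)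
include h

/-- Since `q^{-H}` is affine in `D`, multiplying by it removes the inverse `K` and leaves an
identity in `D, F, G` alone. -/
lemma cancel {x y : A} (hxy : (algebraMap ℂ A a + (q - q⁻¹) • D) * x =
    (algebraMap ℂ A a + (q - q⁻¹) • D) * y) : x = y := by
  rw [← one_mul x, ← one_mul y, ← h.right_inv, mul_assoc, hxy, mul_assoc]

variable (hq : q ≠ 0)
include hq

lemma F_mul_D : F * D = (q ^ 2)⁻¹ • (D * F) - (a * q⁻¹) • F := by
  rw [h.D_mul_F]
  match_scalars <;> field_simp
  ring

lemma borelRel : BorelRel q K (algebraMap ℂ A a + (q - q⁻¹) • D) F where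
  left_inv := h.left_inv
  right_inv := h.right_inv
  comm := by
    simp only [mul_add, add_mul, mul_smul_comm, smul_mul_assoc, h.F_mul_D hq,
      Algebra.algebraMap_eq_smul_one, one_mul, mul_one, smul_sub]
    match_scalars <;> field_simp
    ring

omit hq in
lemma D_mul_K : D * K = K * D := by
  have e : D * (algebraMap ℂ A a + (q - q⁻¹) • D) = (algebraMap ℂ A a + (q - q⁻¹) • D) * D := by
    rw [mul_add, add_mul, Algebra.commutes, mul_smul_comm, smul_mul_assoc]
  apply h.cancel
  rw [← mul_assoc, ← e, mul_assoc, h.left_inv, ← mul_assoc, h.left_inv, mul_one, one_mul]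

lemma F_mul_K : F * K = q ^ 2 • (K * F) := (h.borelRel hq).comm' hq

lemma G_mul_K : G * K = (q ^ 2)⁻¹ • (K * G) := by
  have e : G * (algebraMap ℂ A a + (q - q⁻¹) • D) =
      q ^ 2 • ((algebraMap ℂ A a + (q - q⁻¹) • D) * G) := by
    simp only [mul_add, add_mul, mul_smul_comm, smul_mul_assoc, h.G_mul_D,
      Algebra.algebraMap_eq_smul_one, one_mul, mul_one, smul_add]
    match_scalars <;> field_simp
    ring
  apply h.cancel
  have e' : (algebraMap ℂ A a + (q - q⁻¹) • D) * G =
      (q ^ 2)⁻¹ • (G * (algebraMap ℂ A a + (q - q⁻¹) • D)) := by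
    rw [e, smul_smul, inv_mul_cancel₀ (pow_ne_zero 2 hq), one_smul]
  rw [← mul_assoc, e', smul_mul_assoc, mul_assoc, h.left_inv, mul_smul_comm, ← mul_assoc,
    h.left_inv, mul_one, one_mul]

omit hq in
lemma D_mul_K_assoc (x : A) : D * (K * x) = K * (D * x) := by
  rw [← mul_assoc, h.D_mul_K, mul_assoc]

lemma F_mul_K_assoc (x : A) : F * (K * x) = q ^ 2 • (K * (F * x)) := by
  rw [← mul_assoc, h.F_mul_K hq, smul_mul_assoc, mul_assoc]

lemma G_mul_K_assoc (x : A) : G * (K * x) = (q ^ 2)⁻¹ • (K * (G * x)) := by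
  rw [← mul_assoc, h.G_mul_K hq, smul_mul_assoc, mul_assoc]

lemma F_mul_D_assoc (x : A) : F * (D * x) = (q ^ 2)⁻¹ • (D * (F * x)) - (a * q⁻¹) • (F * x) := by
  rw [← mul_assoc, h.F_mul_D hq, sub_mul, smul_mul_assoc, smul_mul_assoc, mul_assoc]

omit hq in
lemma G_mul_D_assoc (x : A) : G * (D * x) = q ^ 2 • (D * (G * x)) + (a * q) • (G * x) := by
  rw [← mul_assoc, h.G_mul_D, add_mul, smul_mul_assoc, smul_mul_assoc, mul_assoc]

omit hq in
lemma G_mul_F_assoc (x : A) : G * (F * x) =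
    qnum 2 q • ((q⁻¹ * c) • x - a • (D * x) - q • (D * (D * x))) := by
  rw [← mul_assoc, h.G_mul_F]
  simp only [smul_mul_assoc, sub_mul, one_mul, mul_assoc]

omit hq in
lemma left_inv_assoc (x : A) : (algebraMap ℂ A a + (q - q⁻¹) • D) * (K * x) = x := by
  rw [← mul_assoc, h.left_inv, one_mul]

-- This and the next two lemmas say that the columns of `g L⁺` braid with the coordinates exactly as
-- the `ξ_j` do. Words are brought to normal order, with `K` leftmost, then `D`, then only `F`s or
-- only `G`s, since products of `F` and `G` reduce to polynomials in `D`; coefficients are then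
-- compared.
set_option maxHeartbeats 2000000 in
lemma yVec_zero_nMat (h3 : q ^ 2 + 1 ≠ 0) (j b : Fin 3) :
    yVec q D F G 0 * nMat q K (algebraMap ℂ A a + (q - q⁻¹) • D) F j b =
      braidSum q (yVec q D F G) (nMat q K (algebraMap ℂ A a + (q - q⁻¹) • D) F) 0 j b := by
  have hw : qnum 2 q = (q ^ 2 + 1) / q := by rw [qnum_two]; field_simp
  -- `K'` stays opaque until `K' * K` has cancelled, and is expanded in `D` only afterwards.
  obtain ⟨K', hK'⟩ : ∃ K', K' = algebraMap ℂ A a + (q - q⁻¹) • D := ⟨_, rfl⟩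
  have hl := h.left_inv
  have hl' := h.left_inv_assoc
  apply h.cancel
  rw [← hK'] at hl hl' ⊢
  fin_cases j <;> fin_cases b <;>
    simp [braidSum, Fin.sum_univ_three, nMat, yVec, g, eps] <;>
    (try simp only [hw, smul_smul, mul_assoc, mul_smul_comm, smul_mul_assoc, mul_one, one_mul,
      neg_mul, mul_neg, smul_neg, h.D_mul_K, h.D_mul_K_assoc, h.F_mul_K hq,
      h.F_mul_K_assoc hq, h.G_mul_K hq, h.G_mul_K_assoc hq, hl, hl', mul_add, mul_sub, smul_add,
      smul_sub, h.G_mul_D, h.G_mul_D_assoc, h.F_mul_D hq, h.F_mul_D_assoc hq, h.G_mul_F,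
      h.G_mul_F_assoc, h.F_mul_G]) <;>
    (try simp only [hK', hw, smul_smul, mul_assoc, mul_smul_comm, smul_mul_assoc, mul_one, one_mul,
      mul_add, mul_sub, add_mul, sub_mul, smul_add, smul_sub, neg_mul, mul_neg, smul_neg,
      Algebra.algebraMap_eq_smul_one, h.G_mul_D, h.G_mul_D_assoc, h.F_mul_D hq,
      h.F_mul_D_assoc hq, h.G_mul_F, h.G_mul_F_assoc, h.F_mul_G])
  all_goals match_scalars <;> field_simp <;> ring

set_option maxHeartbeats 2000000 in
lemma yVec_one_nMat (h3 : q ^ 2 + 1 ≠ 0) (j b : Fin 3) :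
    yVec q D F G 1 * nMat q K (algebraMap ℂ A a + (q - q⁻¹) • D) F j b =
      braidSum q (yVec q D F G) (nMat q K (algebraMap ℂ A a + (q - q⁻¹) • D) F) 1 j b := by
  have hw : qnum 2 q = (q ^ 2 + 1) / q := by rw [qnum_two]; field_simp
  obtain ⟨K', hK'⟩ : ∃ K', K' = algebraMap ℂ A a + (q - q⁻¹) • D := ⟨_, rfl⟩
  have hl := h.left_inv
  have hl' := h.left_inv_assoc
  apply h.cancel
  rw [← hK'] at hl hl' ⊢
  fin_cases j <;> fin_cases b <;>
    simp [braidSum, Fin.sum_univ_three, nMat, yVec, g, eps] <;>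
    (try simp only [hw, smul_smul, mul_assoc, mul_smul_comm, smul_mul_assoc, mul_one, one_mul,
      neg_mul, mul_neg, smul_neg, h.D_mul_K, h.D_mul_K_assoc, h.F_mul_K hq,
      h.F_mul_K_assoc hq, h.G_mul_K hq, h.G_mul_K_assoc hq, hl, hl', mul_add, mul_sub, smul_add,
      smul_sub, h.G_mul_D, h.G_mul_D_assoc, h.F_mul_D hq, h.F_mul_D_assoc hq, h.G_mul_F,
      h.G_mul_F_assoc, h.F_mul_G]) <;>
    (try simp only [hK', hw, smul_smul, mul_assoc, mul_smul_comm, smul_mul_assoc, mul_one, one_mul,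
      mul_add, mul_sub, add_mul, sub_mul, smul_add, smul_sub, neg_mul, mul_neg, smul_neg,
      Algebra.algebraMap_eq_smul_one, h.G_mul_D, h.G_mul_D_assoc, h.F_mul_D hq,
      h.F_mul_D_assoc hq, h.G_mul_F, h.G_mul_F_assoc, h.F_mul_G])
  all_goals first
    | (match_scalars <;> field_simp <;> ring)
    | (left; field_simp; ring)

set_option maxHeartbeats 2000000 in
lemma yVec_two_nMat (h3 : q ^ 2 + 1 ≠ 0) (j b : Fin 3) :
    yVec q D F G 2 * nMat q K (algebraMap ℂ A a + (q - q⁻¹) • D) F j b =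
      braidSum q (yVec q D F G) (nMat q K (algebraMap ℂ A a + (q - q⁻¹) • D) F) 2 j b := by
  have hw : qnum 2 q = (q ^ 2 + 1) / q := by rw [qnum_two]; field_simp
  obtain ⟨K', hK'⟩ : ∃ K', K' = algebraMap ℂ A a + (q - q⁻¹) • D := ⟨_, rfl⟩
  have hl := h.left_inv
  have hl' := h.left_inv_assoc
  apply h.cancel
  rw [← hK'] at hl hl' ⊢
  fin_cases j <;> fin_cases b <;>
    simp [braidSum, Fin.sum_univ_three, nMat, yVec, g, eps] <;>
    (try simp only [hw, smul_smul, mul_assoc, mul_smul_comm, smul_mul_assoc, mul_one, one_mul,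
      neg_mul, mul_neg, smul_neg, h.D_mul_K, h.D_mul_K_assoc, h.F_mul_K hq,
      h.F_mul_K_assoc hq, h.G_mul_K hq, h.G_mul_K_assoc hq, hl, hl', mul_add, mul_sub, smul_add,
      smul_sub, h.G_mul_D, h.G_mul_D_assoc, h.F_mul_D hq, h.F_mul_D_assoc hq, h.G_mul_F,
      h.G_mul_F_assoc, h.F_mul_G]) <;>
    (try simp only [hK', hw, smul_smul, mul_assoc, mul_smul_comm, smul_mul_assoc, mul_one, one_mul,
      mul_add, mul_sub, add_mul, sub_mul, smul_add, smul_sub, neg_mul, mul_neg, smul_neg,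
      Algebra.algebraMap_eq_smul_one, h.G_mul_D, h.G_mul_D_assoc, h.F_mul_D hq,
      h.F_mul_D_assoc hq, h.G_mul_F, h.G_mul_F_assoc, h.F_mul_G])
  all_goals first
    | (match_scalars <;> field_simp <;> ring)
    | (left; field_simp; ring)

end SphereRel
end abstract_relations

/-! ### The radius and commutation relations of `y_i L^i_a`. -/

section abstract_relations

set_option linter.unusedSimpArgs false
set_option linter.unnecessarySeqFocus false

variable {A : Type*} [Ring A] [Algebra ℂ A]

/-- `y_i L^i_a`. -/
noncomputable def muVec (q a : ℂ) (K D F G : A) (b : Fin 3) : A :=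
  ∑ i, yVec q D F G i * lMat q K (algebraMap ℂ A a + (q - q⁻¹) • D) F i b

namespace SphereRel
variable {q a c : ℂ} {K D F G : A} (h : SphereRel q a c K D F G) (hq : q ≠ 0)
include h hq

set_option maxHeartbeats 2000000 in
lemma g_muVec (h3 : q ^ 2 + 1 ≠ 0) :
    ∑ b, ∑ d, g q d b • (muVec q a K D F G b * muVec q a K D F G d) =
      algebraMap ℂ A (qnum 2 q ^ 2 * c / q ^ 4) := by
  have hw : qnum 2 q = (q ^ 2 + 1) / q := by rw [qnum_two]; field_simp
  simp only [muVec]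
  obtain ⟨K', hK'⟩ : ∃ K', K' = algebraMap ℂ A a + (q - q⁻¹) • D := ⟨_, rfl⟩
  have hl := h.left_inv
  have hl' := h.left_inv_assoc
  -- Each of the two factors has degree at most one in `K`, so two multiplications by `q^{-H}` clear
  -- it.
  apply h.cancel
  apply h.cancel
  rw [← hK'] at hl hl' ⊢
  simp [Fin.sum_univ_three, lMat, yVec, g] <;>
    (try simp only [hw, smul_smul, mul_assoc, mul_smul_comm, smul_mul_assoc, mul_one, one_mul,
      neg_mul, mul_neg, smul_neg, h.D_mul_K, h.D_mul_K_assoc, h.F_mul_K hq,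
      h.F_mul_K_assoc hq, h.G_mul_K hq, h.G_mul_K_assoc hq, hl, hl', mul_add, mul_sub, smul_add,
      add_mul, sub_mul,
      smul_sub, h.G_mul_D, h.G_mul_D_assoc, h.F_mul_D hq, h.F_mul_D_assoc hq, h.G_mul_F,
      h.G_mul_F_assoc, h.F_mul_G]) <;>
    (try simp only [hK', hw, smul_smul, mul_assoc, mul_smul_comm, smul_mul_assoc, mul_one, one_mul,
      mul_add, mul_sub, add_mul, sub_mul, smul_add, smul_sub, neg_mul, mul_neg, smul_neg,
      Algebra.algebraMap_eq_smul_one, h.G_mul_D, h.G_mul_D_assoc, h.F_mul_D hq,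
      h.F_mul_D_assoc hq, h.G_mul_F, h.G_mul_F_assoc, h.F_mul_G])
  match_scalars <;> field_simp <;> ring

set_option maxHeartbeats 2000000 in
lemma eps_muVec (h3 : q ^ 2 + 1 ≠ 0) (e : Fin 3) :
    ∑ b, ∑ d, eps q d b e • (muVec q a K D F G b * muVec q a K D F G d) =
      (-(qnum 2 q * a / q ^ 2)) • muVec q a K D F G e := by
  have hw : qnum 2 q = (q ^ 2 + 1) / q := by rw [qnum_two]; field_simp
  simp only [muVec]
  obtain ⟨K', hK'⟩ : ∃ K', K' = algebraMap ℂ A a + (q - q⁻¹) • D := ⟨_, rfl⟩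
  have hl := h.left_inv
  have hl' := h.left_inv_assoc
  apply h.cancel
  apply h.cancel
  rw [← hK'] at hl hl' ⊢
  fin_cases e <;>
    simp [Fin.sum_univ_three, lMat, yVec, eps] <;>
    (try simp only [hw, smul_smul, mul_assoc, mul_smul_comm, smul_mul_assoc, mul_one, one_mul,
      neg_mul, mul_neg, smul_neg, h.D_mul_K, h.D_mul_K_assoc, h.F_mul_K hq,
      h.F_mul_K_assoc hq, h.G_mul_K hq, h.G_mul_K_assoc hq, hl, hl', mul_add, mul_sub, smul_add,
      add_mul, sub_mul,
      smul_sub, h.G_mul_D, h.G_mul_D_assoc, h.F_mul_D hq, h.F_mul_D_assoc hq, h.G_mul_F,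
      h.G_mul_F_assoc, h.F_mul_G]) <;>
    (try simp only [hK', hw, smul_smul, mul_assoc, mul_smul_comm, smul_mul_assoc, mul_one, one_mul,
      mul_add, mul_sub, add_mul, sub_mul, smul_add, smul_sub, neg_mul, mul_neg, smul_neg,
      Algebra.algebraMap_eq_smul_one, h.G_mul_D, h.G_mul_D_assoc, h.F_mul_D hq,
      h.F_mul_D_assoc hq, h.G_mul_F, h.G_mul_F_assoc, h.F_mul_G])
  all_goals match_scalars <;> field_simp <;> ring

end SphereRel

end abstract_relations

/-! ### Contractions of the invariant tensors. -/

section tensors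

lemma eps_contract (q : ℂ) (hq : q ≠ 0) (m n : Fin 3) :
    ∑ i, ∑ j, eps q i j m * eps q i j n = if m = n then qnum 2 (q ^ 2) else 0 := by
  rw [qnum_two]
  fin_cases m <;> fin_cases n <;> simp [Fin.sum_univ_three, eps] <;> field_simp <;> ring

lemma g_eps_contract (q : ℂ) (hq : q ≠ 0) (n : Fin 3) : ∑ i, ∑ j, g q i j * eps q i j n = 0 := by
  fin_cases n <;> simp [Fin.sum_univ_three, eps, g]
  field_simp
  ring

lemma g_contract (q : ℂ) (hq : q ≠ 0) : ∑ i, ∑ j, g q i j * g q i j = qnum 3 q := by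
  rw [qnum_three]
  simp [Fin.sum_univ_three, g]
  field_simp
  ring

/-- The two ways of raising an index of `ε` agree. This is associativity of the frame's exterior
algebra in degree three, which the model needs. -/
lemma g_eps_cyclic (q : ℂ) (hq : q ≠ 0) (a b c : Fin 3) :
    ∑ n, g q c n * eps q b a n = ∑ n, eps q c b n * g q n a := by
  fin_cases a <;> fin_cases b <;> fin_cases c <;> simp [Fin.sum_univ_three, eps, g] <;> field_simp

lemma g_mul_g (q : ℂ) (hq : q ≠ 0) (i k : Fin 3) :
    ∑ j, g q i j * g q j k = if i = k then 1 else 0 := by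
  fin_cases i <;> fin_cases k <;> simp [Fin.sum_univ_three, g, hq]

variable {M : Type*} [AddCommGroup M] [Module ℂ M] {q : ℂ}

lemma sum_Rhat_smul (hq : q ≠ 0) (h3 : qnum 3 q ≠ 0) (h4 : qnum 2 (q ^ 2) ≠ 0)
    (E : Fin 3 → Fin 3 → M) (i j : Fin 3) :
    ∑ k, ∑ l, Rhat q k l i j • E k l = q ^ 2 • E i j
      - ∑ n, eps q i j n • ∑ k, ∑ l, eps q k l n • E k l
      + (((q ^ 2)⁻¹ - 1) * g q i j) • ∑ k, ∑ l, g q k l • E k l := by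
  have e1 : ∑ k, ∑ l, (q ^ 2 * (if k = i ∧ l = j then 1 else 0)) • E k l = q ^ 2 • E i j := by
    rw [Finset.sum_eq_single i, Finset.sum_eq_single j] <;> simp +contextual
  have e2 : ∑ k, ∑ l, (∑ n, eps q k l n * eps q i j n) • E k l =
      ∑ n, eps q i j n • ∑ k, ∑ l, eps q k l n • E k l := by
    simp only [Finset.sum_smul, Finset.smul_sum, smul_smul]
    rw [Finset.sum_comm]
    conv_lhs => rw [Finset.sum_comm]; enter [2, k]; rw [Finset.sum_comm]
    rw [Finset.sum_comm]
    simp only [mul_comm]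
  have e3 : ∑ k, ∑ l, (((q ^ 2)⁻¹ - 1) * (g q k l * g q i j)) • E k l =
      (((q ^ 2)⁻¹ - 1) * g q i j) • ∑ k, ∑ l, g q k l • E k l := by
    simp only [Finset.smul_sum, smul_smul]
    refine Finset.sum_congr rfl fun k _ => Finset.sum_congr rfl fun l _ => ?_
    congr 1
    ring
  simp only [Rhat_eq hq h3 h4, add_smul, sub_smul, Finset.sum_add_distrib, Finset.sum_sub_distrib,
    e1, e2, e3]

end tensors

/-! ### The concrete `S²_{q,N}` as an instance of the abstract relations. -/

section sphere

variable {N : ℕ} {q : ℂ} {r : ℝ}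

lemma sq_add_one_ne_zero (hq : q ≠ 0) (h2 : qnum 2 q ≠ 0) : q ^ 2 + 1 ≠ 0 := by
  intro h
  apply h2
  rw [qnum_two]
  field_simp
  linear_combination h

lemma sphereRel (hq : q ≠ 0) (h2 : qnum 2 q ≠ 0) :
    SphereRel q (sphA N q) (sphC N q) (jK N q) (sphD N q) (sphF N q) (sphG N q) where
  left_inv := by
    rw [← jKinv_eq, jK, Ring.mul_inverse_cancel _ (isUnit_jKinv hq h2)]
  right_inv := by
    rw [← jKinv_eq, jK, Ring.inverse_mul_cancel _ (isUnit_jKinv hq h2)]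
  D_mul_F := sphD_mul_sphF hq h2
  G_mul_D := sphG_mul_sphD hq h2
  G_mul_F := sphG_mul_sphF hq h2
  F_mul_G := sphF_mul_sphG hq h2

lemma jF_eq (h2 : qnum 2 q ≠ 0) : jF N q = (csqrt (qnum 2 q))⁻¹ • sphF N q := by
  rw [sphF, smul_smul, inv_mul_cancel₀ (csqrt_ne_zero h2), one_smul]

lemma x_eq (hq : q ≠ 0) (h2 : qnum 2 q ≠ 0) (i : Fin 3) :
    x N q r i = (r / rootNN N q) • yVec q (sphD N q) (sphF N q) (sphG N q) i := by
  have hw := csqrt_mul_self (qnum 2 q)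
  have hw0 := csqrt_ne_zero h2
  generalize hw' : csqrt (qnum 2 q) = w at hw hw0
  fin_cases i <;> simp [x, yVec, sphD, sphF, sphG, jF, smul_smul, hw'] <;> congr 1
  · ring
  · rw [← hw]; field_simp
  · ring

lemma lplus_eq (hq : q ≠ 0) (h2 : qnum 2 q ≠ 0) (i j : Fin 3) :
    Lplus N q i j = lMat q (jK N q) (jKinv N q) (sphF N q) i j := by
  have hw := csqrt_mul_self (qnum 2 q)
  have hw0 := csqrt_ne_zero h2
  have h1 : qnum 1 q = 1 := by simp [qnum]
  simp only [Lplus, piE, jF_eq h2]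
  generalize csqrt (qnum 2 q) = w at hw hw0
  fin_cases i <;> fin_cases j <;>
    simp [Finset.sum_range_succ, Rcoeff, Finset.prod_range_succ, lMat, jT, h1, pow_two,
      ← hw, smul_smul]
  all_goals congr 1; field_simp

/-- The factor `w = √[2]_q` in `π(X⁺)` cancels against the `w⁻¹` in `X⁻ q^{-H/2} = w⁻¹ F`, so that
no square root is left in the entries. -/
lemma slMat_eq_sum {A : Type*} [Ring A] [Algebra ℂ A] {w : ℂ} (hw : w * w = qnum 2 q)
    (hw0 : w ≠ 0) {K K' F : A} (hi : K * K' = 1) (i j : Fin 3) :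
    ∑ n ∈ Finset.range 3,
      (Rcoeff q n * ((w • !![0, q, 0; 0, 0, 1; 0, 0, 0] : Matrix (Fin 3) (Fin 3) ℂ) ^ n) i j) •
        ((-((w⁻¹ • F) * K)) ^ n * (![K', 1, K] : Fin 3 → A) i) = slMat q K K' F i j := by
  have h1 : qnum 1 q = 1 := by simp [qnum]
  fin_cases i <;> fin_cases j <;>
    simp [Finset.sum_range_succ, Rcoeff, Finset.prod_range_succ, slMat, h1, pow_two, ← hw,
      smul_smul, mul_assoc, hi]
  all_goals (match_scalars; field_simp)
  all_goals ring

lemma slplus_eq (hq : q ≠ 0) (h2 : qnum 2 q ≠ 0) (i j : Fin 3) :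
    SLplus N q i j = slMat q (jK N q) (jKinv N q) (sphF N q) i j := by
  rw [← slMat_eq_sum (K := jK N q) (F := sphF N q) (csqrt_mul_self (qnum 2 q)) (csqrt_ne_zero h2)
    (Ring.inverse_mul_cancel _ (isUnit_jKinv hq h2)), SLplus, jSF, jF_eq h2]
  rfl

end sphere

/-! ### The eigenspaces of `R̂` on arrays with entries in a module. -/

section module_lemmas

variable {M : Type*} [AddCommGroup M] [Module ℂ M] {q : ℂ}

lemma sum_Rhat_smul_swap (hq : q ≠ 0) (h3 : qnum 3 q ≠ 0) (h4 : qnum 2 (q ^ 2) ≠ 0)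
    (E : Fin 3 → Fin 3 → M) (a b : Fin 3) :
    ∑ c, ∑ d, Rhat q d c b a • E c d = q ^ 2 • E a b
      - ∑ n, eps q b a n • ∑ c, ∑ d, eps q d c n • E c d
      + (((q ^ 2)⁻¹ - 1) * g q b a) • ∑ c, ∑ d, g q d c • E c d := by
  have h := sum_Rhat_smul hq h3 h4 (fun k l => E l k) b a
  rw [Finset.sum_comm] at h
  rw [h, Finset.sum_comm (f := fun c d => g q d c • E c d)]
  congr 3
  ext n
  rw [Finset.sum_comm]

lemma Rhat_symm (hq : q ≠ 0) (h3 : qnum 3 q ≠ 0) (h4 : qnum 2 (q ^ 2) ≠ 0) (i j k l : Fin 3) :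
    Rhat q i j k l = Rhat q k l i j := by
  rw [Rhat_eq hq h3 h4, Rhat_eq hq h3 h4]
  simp only [eq_comm (a := i), eq_comm (a := j), mul_comm (g q i j), mul_comm (eps q i j _)]

lemma eps_smul_eps_smul (hq : q ≠ 0) (e : Fin 3 → M) (m : Fin 3) :
    ∑ i, ∑ j, eps q i j m • ∑ n, eps q i j n • e n = qnum 2 (q ^ 2) • e m := by
  simp only [Finset.smul_sum, smul_smul]
  conv_lhs => enter [2, i]; rw [Finset.sum_comm]
  rw [Finset.sum_comm]
  simp only [← Finset.sum_smul, eps_contract q hq]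
  simp

lemma eps_smul_g_smul (hq : q ≠ 0) (e : M) (m : Fin 3) :
    ∑ i, ∑ j, eps q i j m • g q i j • e = 0 := by
  simp only [smul_smul, ← Finset.sum_smul, mul_comm (eps q _ _ _), g_eps_contract q hq, zero_smul]

lemma g_smul_eps_smul (hq : q ≠ 0) (e : Fin 3 → M) :
    ∑ i, ∑ j, g q i j • ∑ n, eps q i j n • e n = 0 := by
  simp only [Finset.smul_sum, smul_smul]
  conv_lhs => enter [2, i]; rw [Finset.sum_comm]
  rw [Finset.sum_comm]
  simp only [← Finset.sum_smul, g_eps_contract q hq]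
  simp

lemma g_smul_g_smul (hq : q ≠ 0) (e : M) :
    ∑ i, ∑ j, g q i j • g q i j • e = qnum 3 q • e := by
  simp only [smul_smul, ← Finset.sum_smul, g_contract q hq]

lemma eps_smul_sum_Rhat_smul (hq : q ≠ 0) (h3 : qnum 3 q ≠ 0) (h4 : qnum 2 (q ^ 2) ≠ 0)
    (E : Fin 3 → Fin 3 → M) (m : Fin 3) :
    ∑ i, ∑ j, eps q i j m • ∑ k, ∑ l, Rhat q k l i j • E k l =
      (-(q ^ 2)⁻¹) • ∑ k, ∑ l, eps q k l m • E k l := by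
  simp only [sum_Rhat_smul hq h3 h4, smul_add, smul_sub, Finset.sum_add_distrib,
    Finset.sum_sub_distrib, mul_smul]
  rw [eps_smul_eps_smul hq]
  simp only [smul_comm (eps q _ _ _) (q ^ 2), smul_comm (eps q _ _ _) ((q ^ 2)⁻¹ - 1),
    ← Finset.smul_sum]
  rw [eps_smul_g_smul hq, smul_zero, add_zero, ← sub_smul, qnum_two]
  congr 1
  ring

lemma g_smul_sum_Rhat_smul (hq : q ≠ 0) (h3 : qnum 3 q ≠ 0) (h4 : qnum 2 (q ^ 2) ≠ 0)
    (E : Fin 3 → Fin 3 → M) :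
    ∑ i, ∑ j, g q i j • ∑ k, ∑ l, Rhat q k l i j • E k l =
      (q ^ 4)⁻¹ • ∑ k, ∑ l, g q k l • E k l := by
  simp only [sum_Rhat_smul hq h3 h4, smul_add, smul_sub, Finset.sum_add_distrib,
    Finset.sum_sub_distrib, mul_smul]
  rw [g_smul_eps_smul hq]
  simp only [smul_comm (g q _ _) (q ^ 2), smul_comm (g q _ _) ((q ^ 2)⁻¹ - 1),
    ← Finset.smul_sum]
  rw [g_smul_g_smul hq, sub_zero, smul_smul, ← add_smul, qnum_three]
  congr 1
  field_simp
  ring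

/-- `R̂` is injective. -/
lemma eq_zero_of_sum_Rhat_smul (hq : q ≠ 0) (h3 : qnum 3 q ≠ 0) (h4 : qnum 2 (q ^ 2) ≠ 0)
    (E : Fin 3 → Fin 3 → M) (hE : ∀ i j, ∑ k, ∑ l, Rhat q k l i j • E k l = 0) (i j : Fin 3) :
    E i j = 0 := by
  -- The `ε`- and `g`-contractions are multiplied by the nonzero eigenvalues `-q⁻²` and `q⁻⁴`, so
  -- both vanish; what is left of `R̂ E` is `q² E`.
  have he : ∀ m, ∑ k, ∑ l, eps q k l m • E k l = 0 := by
    intro m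
    have := eps_smul_sum_Rhat_smul hq h3 h4 E m
    simp only [hE, smul_zero, Finset.sum_const_zero] at this
    exact (smul_eq_zero.1 this.symm).resolve_left (neg_ne_zero.2 (inv_ne_zero (pow_ne_zero 2 hq)))
  have hg : ∑ k, ∑ l, g q k l • E k l = 0 := by
    have := g_smul_sum_Rhat_smul hq h3 h4 E
    simp only [hE, smul_zero, Finset.sum_const_zero] at this
    exact (smul_eq_zero.1 this.symm).resolve_left (inv_ne_zero (pow_ne_zero 4 hq))
  have := sum_Rhat_smul hq h3 h4 E i j
  simp only [hE, he, hg, smul_zero, Finset.sum_const_zero, sub_zero, add_zero] at this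
  exact (smul_eq_zero.1 this.symm).resolve_left (pow_ne_zero 2 hq)

/-- The solutions of `E = -q² R̂ E` lie in the image of `P⁻`. -/
lemma eq_eps_of_sum_Rhat_smul (hq : q ≠ 0) (h2 : q ^ 2 + 1 ≠ 0) (h3 : qnum 3 q ≠ 0)
    (h4 : qnum 2 (q ^ 2) ≠ 0) (E : Fin 3 → Fin 3 → M)
    (hE : ∀ i j, E i j = (-q ^ 2) • ∑ k, ∑ l, Rhat q i j k l • E k l) (i j : Fin 3) :
    E i j = ∑ n, eps q i j n • (qnum 2 (q ^ 2))⁻¹ • ∑ k, ∑ l, eps q k l n • E k l := by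
  have hE' : ∀ i j, E i j = (-q ^ 2) • ∑ k, ∑ l, Rhat q k l i j • E k l := by
    intro i j
    rw [hE]
    simp only [Rhat_symm hq h3 h4 i j]
  -- On the image of `P⁰` the operator `-q² R̂` is `-q⁻²`, and `1 + q⁻² ≠ 0`, so a fixed array has
  -- no `g`-part.
  have hg : ∑ k, ∑ l, g q k l • E k l = 0 := by
    have h := g_smul_sum_Rhat_smul hq h3 h4 E
    have h' : ∑ i, ∑ j, g q i j • E i j =
        (-q ^ 2) • ∑ i, ∑ j, g q i j • ∑ k, ∑ l, Rhat q k l i j • E k l := by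
      simp only [Finset.smul_sum (r := -q ^ 2), smul_comm (-q ^ 2) (g q _ _)]
      simp only [← Finset.smul_sum (r := -q ^ 2)]
      simp only [← hE']
    rw [h, smul_smul, ← sub_eq_zero] at h'
    nth_rewrite 1 [← one_smul ℂ (∑ i, ∑ j, g q i j • E i j)] at h'
    rw [← sub_smul] at h'
    refine (smul_eq_zero.1 h').resolve_left fun h0 => h2 ?_
    field_simp at h0
    linear_combination h0
  have := hE' i j
  rw [sum_Rhat_smul hq h3 h4, hg, smul_zero, add_zero] at this
  simp only [smul_comm _ (qnum 2 (q ^ 2))⁻¹, ← Finset.smul_sum]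
  rw [eq_inv_smul_iff₀ h4, qnum_two]
  generalize ∑ n, eps q i j n • ∑ k, ∑ l, eps q k l n • E k l = S at this ⊢
  -- Here `1 + q⁴ = q² [2]_{q²}` is invertible, which excludes a `P⁺`-part, where `-q² R̂` is `-q⁴`.
  have e : (1 + q ^ 4) • E i j = q ^ 2 • S := by
    linear_combination (norm := (match_scalars <;> field_simp <;> ring)) this
  rw [show q ^ 2 + (q ^ 2)⁻¹ = (q ^ 2)⁻¹ * (1 + q ^ 4) by field_simp; ring, mul_smul, e, smul_smul,
    inv_mul_cancel₀ (pow_ne_zero 2 hq), one_smul]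

end module_lemmas

/-! ### The inverse of `g L⁺` and the RLL relation. -/

section abstract_relations

variable {A : Type*} [Ring A] [Algebra ℂ A] {q : ℂ} {K K' F : A}

/-- The inverse of `nMat`. -/
noncomputable def wMat (q : ℂ) (K K' F : A) (b k : Fin 3) : A :=
  ∑ j, g q j k • slMat q K K' F b j

namespace BorelRel

variable (h : BorelRel q K K' F) (hq : q ≠ 0) (h2 : q ^ 2 + 1 ≠ 0)
include h hq h2

lemma wMat_mul_nMat (b a : Fin 3) :
    ∑ k, wMat q K K' F b k * nMat q K K' F k a = if b = a then 1 else 0 := by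
  have e : ∀ k, wMat q K K' F b k * nMat q K K' F k a =
      ∑ j, ∑ m, (g q j k * g q k m) • (slMat q K K' F b j * lMat q K K' F m a) := by
    intro k
    simp only [wMat, nMat_eq hq, Finset.sum_mul_sum, smul_mul_smul_comm]
  rw [← h.slMat_mul_lMat hq h2]
  simp only [e]
  rw [Finset.sum_comm]
  refine Finset.sum_congr rfl fun j _ => ?_
  rw [Finset.sum_comm]
  simp only [← Finset.sum_smul, g_mul_g q hq]
  simp

lemma nMat_mul_wMat (i k : Fin 3) :
    ∑ a, nMat q K K' F i a * wMat q K K' F a k = if i = k then 1 else 0 := by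
  have e : ∀ a, nMat q K K' F i a * wMat q K K' F a k =
      ∑ m, ∑ j, (g q i m * g q j k) • (lMat q K K' F m a * slMat q K K' F a j) := by
    intro k
    simp only [wMat, nMat_eq hq, Finset.sum_mul_sum, smul_mul_smul_comm]
  simp only [e]
  rw [Finset.sum_comm]
  have e' : ∀ m, ∑ a, ∑ j, (g q i m * g q j k) • (lMat q K K' F m a * slMat q K K' F a j) =
      (g q i m * g q m k) • (1 : A) := by
    intro m
    rw [Finset.sum_comm]
    simp only [← Finset.smul_sum, h.lMat_mul_slMat hq h2]
    simp
  simp only [e', ← Finset.sum_smul, g_mul_g q hq]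
  simp

omit h h2 in
lemma sum_g_nMat (i a : Fin 3) : ∑ j, g q i j • nMat q K K' F j a = lMat q K K' F i a := by
  simp only [nMat_eq hq, Finset.smul_sum, smul_smul]
  rw [Finset.sum_comm]
  simp only [← Finset.sum_smul, g_mul_g q hq]
  simp

/-- The `RLL` relation. -/
lemma sum_Rhat_nMat_nMat (h3 : qnum 3 q ≠ 0) (h4 : qnum 2 (q ^ 2) ≠ 0) (i j a b : Fin 3) :
    ∑ k, ∑ l, Rhat q k l i j • (nMat q K K' F k a * nMat q K K' F l b) =
      ∑ c, ∑ d, Rhat q d c b a • (nMat q K K' F i c * nMat q K K' F j d) := by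
  rw [sum_Rhat_smul hq h3 h4 (fun k l => nMat q K K' F k a * nMat q K K' F l b),
    sum_Rhat_smul_swap hq h3 h4 (fun c d => nMat q K K' F i c * nMat q K K' F j d)]
  simp only [h.eps_nMat_nMat hq h2, h.nMat_nMat_eps hq h2, h.g_nMat_nMat hq h2,
    h.nMat_nMat_g hq h2]
  congr 1
  · congr 1
    simp only [Finset.smul_sum]
    rw [Finset.sum_comm]
    exact Finset.sum_congr rfl fun n _ => Finset.sum_congr rfl fun m _ => smul_comm _ _ _
  · simp only [Algebra.algebraMap_eq_smul_one, smul_smul]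
    congr 1
    ring

end BorelRel
end abstract_relations

/-! ### The exterior algebra of the frame. -/

section exterior

variable {B : Type*} [Ring B] [Algebra ℂ B] {q : ℂ} {T : Fin 3 → B}

lemma frame_mul (hq : q ≠ 0) (h2 : q ^ 2 + 1 ≠ 0) (h3 : qnum 3 q ≠ 0)
    (h4 : qnum 2 (q ^ 2) ≠ 0)
    (hT : ∀ a b, T a * T b = (-q ^ 2) • ∑ c, ∑ d, Rhat q b a c d • (T d * T c)) (a b : Fin 3) :
    T a * T b = ∑ n, eps q b a n • (qnum 2 (q ^ 2))⁻¹ • ∑ k, ∑ l, eps q k l n • (T l * T k) :=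
  eq_eps_of_sum_Rhat_smul hq h2 h3 h4 (fun b a => T a * T b) (fun b a => hT a b) b a

/-- In the exterior algebra of the frame, degree three is spanned by one element. -/
lemma frame_mul_mul (hq : q ≠ 0) (h2 : q ^ 2 + 1 ≠ 0) (h3 : qnum 3 q ≠ 0)
    (h4 : qnum 2 (q ^ 2) ≠ 0)
    (hT : ∀ a b, T a * T b = (-q ^ 2) • ∑ c, ∑ d, Rhat q b a c d • (T d * T c)) :
    ∃ V : B, ∀ a b c, T a * T b * T c = epsUp q c b a • V := by
  obtain ⟨η, hη⟩ : ∃ η : Fin 3 → B, ∀ a b, T a * T b = ∑ n, eps q b a n • η n :=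
    ⟨_, frame_mul hq h2 h3 h4 hT⟩
  -- Associativity of `T a * T b * T c`, written through the two-forms `η n`.
  have key : ∀ a b c, ∑ n, eps q b a n • (η n * T c) = ∑ n, eps q c b n • (T a * η n) := by
    intro a b c
    have := mul_assoc (T a) (T b) (T c)
    rw [hη a b, hη b c] at this
    simpa only [Finset.sum_mul, Finset.mul_sum, smul_mul_assoc, mul_smul_comm] using this
  -- Suitable index triples in `key` form a linear system that expresses every `η n * T c` through
  -- `η 1 * T 1`. This one serves as `V`, since `g^{00} = 1` (position `1` is the vector index `0`).
  have hX : ∀ n c, η n * T c = g q c n • (η 1 * T 1) := by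
    have k1 := key 0 1 0
    have k2 := key 0 1 1
    have k3 := key 0 1 2
    have k4 := key 0 2 1
    have k5 := key 1 2 0
    have k6 := key 2 2 0
    have k7 := key 1 0 0
    have k8 := key 2 0 0
    have k9 := key 1 0 2
    have k10 := key 2 0 1
    have l1 := key 0 0 1
    have l2 := key 0 0 2
    have l3 := key 0 2 2
    have l4 := key 1 2 2
    have l5 := key 2 1 1
    have l6 := key 2 2 1
    have l7 := key 1 2 1
    simp [Fin.sum_univ_three, eps, hq] at k1 k2 k3 k4 k5 k6 k7 k8 k9 k10 l1 l2 l3 l4 l5 l6 l7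
    have x02 : η 0 * T 2 = (-q) • (η 1 * T 1) := by
      linear_combination (norm := (match_scalars <;> field_simp <;> ring)) k3 - q • k4
    have x20 : η 2 * T 0 = (-q⁻¹) • (η 1 * T 1) := by
      linear_combination (norm := (match_scalars <;> field_simp <;> ring))
        (-q⁻¹) • k5 - q⁻¹ • k9 + (q ^ 2)⁻¹ • x02
    have x01 : η 0 * T 1 = 0 := by simpa [l2, hq] using k2
    have x21 : η 2 * T 1 = 0 := by simpa [← k6, hq] using l5
    intro n c
    fin_cases n <;> fin_cases c <;> simp [g, k7, k8, l3, l4, x01, x21, x02, x20]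
  refine ⟨η 1 * T 1, fun a b c => ?_⟩
  rw [hη, Finset.sum_mul, epsUp, Finset.sum_smul]
  refine Finset.sum_congr rfl fun n _ => ?_
  rw [smul_mul_assoc, hX n c, smul_smul, mul_comm]

end exterior

/-! ### The frame inside the calculus and the relations of `λ_a`. -/

section forms

variable (N : ℕ) (q : ℂ) (r : ℝ)

/-- The standing assumptions on the deformation parameter. -/
structure Generic (N : ℕ) (q : ℂ) (r : ℝ) : Prop where
  q_ne : q ≠ 0
  r_ne : (r : ℂ) ≠ 0
  two_ne : qnum 2 q ≠ 0
  three_ne : qnum 3 q ≠ 0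
  four_ne : qnum 2 (q ^ 2) ≠ 0
  root_ne : rootNN N q ≠ 0
  top_ne : qnum 2 (q ^ (N + 1)) ≠ 0

/-- `fn` as a homomorphism of algebras. -/
noncomputable def fnHom : Sphere N q →ₐ[ℂ] Forms N q r where
  toFun := fn N q r
  map_one' := by
    have := RingQuot.mkAlgHom_rel ℂ (FormRel.scalar (N := N) (q := q) (r := r) 1)
    simpa [fn] using this
  map_mul' f h := by
    have := RingQuot.mkAlgHom_rel ℂ (FormRel.mul (N := N) (q := q) (r := r) f h)
    simpa [fn] using this
  map_zero' := by
    have := RingQuot.mkAlgHom_rel ℂ (FormRel.scalar (N := N) (q := q) (r := r) 0)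
    simpa [fn] using this
  map_add' f h := by
    have := RingQuot.mkAlgHom_rel ℂ (FormRel.add (N := N) (q := q) (r := r) f h)
    simpa [fn] using this
  commutes' c := by
    have := RingQuot.mkAlgHom_rel ℂ (FormRel.scalar (N := N) (q := q) (r := r) c)
    simpa [fn] using this

lemma fn_eq (f : Sphere N q) : fn N q r f = fnHom N q r f := rfl

lemma x_mul_xi (i j : Fin 3) : fnHom N q r (x N q r i) * xi N q r j =
    ∑ k, ∑ l, Rhat q k l i j • (xi N q r k * fnHom N q r (x N q r l)) := by
  have := RingQuot.mkAlgHom_rel ℂ (FormRel.braid (N := N) (q := q) (r := r) i j)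
  simp only [map_mul, map_sum, map_smul] at this
  exact this

lemma xi_mul_xi (i j : Fin 3) : xi N q r i * xi N q r j =
    (-q ^ 2) • ∑ k, ∑ l, Rhat q k l i j • (xi N q r k * xi N q r l) := by
  have := RingQuot.mkAlgHom_rel ℂ (FormRel.ext (N := N) (q := q) (r := r) i j)
  simp only [map_mul, map_sum, map_smul] at this
  exact this

/-- `g_{jk} L^k_a` in the `q`-deformed fuzzy sphere. -/
noncomputable def sphN (j a : Fin 3) : Sphere N q := nMat q (jK N q) (jKinv N q) (sphF N q) j a

/-- The inverse of `sphN`. -/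
noncomputable def sphW (a k : Fin 3) : Sphere N q := wMat q (jK N q) (jKinv N q) (sphF N q) a k

variable {N q r} (hG : Generic N q r)
include hG

namespace Generic

lemma borel : BorelRel q (jK N q) (jKinv N q) (sphF N q) := by
  rw [jKinv_eq]
  exact (sphereRel hG.q_ne hG.two_ne).borelRel hG.q_ne

lemma sq_ne : q ^ 2 + 1 ≠ 0 := sq_add_one_ne_zero hG.q_ne hG.two_ne

lemma Lam_ne : Lam N q r ≠ 0 :=
  div_ne_zero (mul_ne_zero hG.r_ne hG.top_ne) hG.root_ne

lemma sphW_mul_sphN (b a : Fin 3) : ∑ k, sphW N q b k * sphN N q k a = if b = a then 1 else 0 :=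
  hG.borel.wMat_mul_nMat hG.q_ne hG.sq_ne b a

lemma sphN_mul_sphW (i k : Fin 3) : ∑ a, sphN N q i a * sphW N q a k = if i = k then 1 else 0 :=
  hG.borel.nMat_mul_wMat hG.q_ne hG.sq_ne i k

lemma x_mul_sphN (i j a : Fin 3) : x N q r i * sphN N q j a =
    ∑ k, ∑ l, Rhat q k l i j • (sphN N q k a * x N q r l) := by
  have h := sphereRel (N := N) hG.q_ne hG.two_ne
  have key : yVec q (sphD N q) (sphF N q) (sphG N q) i * sphN N q j a =
      ∑ k, ∑ l, Rhat q k l i j • (sphN N q k a * yVec q (sphD N q) (sphF N q) (sphG N q) l) := by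
    simp only [Rhat_eq hG.q_ne hG.three_ne hG.four_ne, sphN, jKinv_eq]
    match i with
    | 0 => exact h.yVec_zero_nMat hG.q_ne hG.sq_ne j a
    | 1 => exact h.yVec_one_nMat hG.q_ne hG.sq_ne j a
    | 2 => exact h.yVec_two_nMat hG.q_ne hG.sq_ne j a
  simp only [x_eq hG.q_ne hG.two_ne, smul_mul_assoc, mul_smul_comm, key, Finset.smul_sum]
  exact Finset.sum_congr rfl fun k _ => Finset.sum_congr rfl fun l _ => smul_comm _ _ _

lemma theta_eq (a : Fin 3) :
    theta N q r a = Lam N q r • ∑ k, fnHom N q r (sphW N q a k) * xi N q r k := by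
  simp only [theta, sphW, wMat, slplus_eq hG.q_ne hG.two_ne, fn_eq, map_sum, map_smul,
    Finset.sum_mul, smul_mul_assoc]
  rw [Finset.sum_comm]

lemma sphN_theta (j : Fin 3) :
    ∑ a, fnHom N q r (sphN N q j a) * theta N q r a = Lam N q r • xi N q r j := by
  simp only [hG.theta_eq, mul_smul_comm, ← Finset.smul_sum, Finset.mul_sum]
  rw [Finset.sum_comm]
  simp only [← mul_assoc, ← map_mul, ← Finset.sum_mul, ← map_sum, hG.sphN_mul_sphW]
  simp

lemma xi_eq (j : Fin 3) : xi N q r j =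
    (Lam N q r)⁻¹ • ∑ a, fnHom N q r (sphN N q j a) * theta N q r a := by
  rw [hG.sphN_theta, smul_smul, inv_mul_cancel₀ hG.Lam_ne, one_smul]

/-- Cancellation of `sphN` in a bimodule. -/
lemma eq_zero_of_sphN_mul {B : Type*} [Ring B] [Algebra ℂ B] (φ : Sphere N q →ₐ[ℂ] B)
    (E : Fin 3 → B) (hE : ∀ k, ∑ a, φ (sphN N q k a) * E a = 0) (a : Fin 3) : E a = 0 := by
  have h : ∑ k, φ (sphW N q a k) * ∑ b, φ (sphN N q k b) * E b = E a := by
    simp only [Finset.mul_sum, ← mul_assoc, ← map_mul]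
    rw [Finset.sum_comm]
    simp only [← Finset.sum_mul, ← map_sum, hG.sphW_mul_sphN]
    simp
  rw [← h]
  simp [hE]

/-- Both `Λ_N ξ_j = N_{ja} θ^a` and `N_{ja}` alone pass `x_i` through the same `R̂`. The difference
of the two statements is `R̂` applied to `N_{ka} (θ^a x_l - x_l θ^a)`, and `R̂` and `N` can be
cancelled. -/
lemma theta_mul_x (a l : Fin 3) : theta N q r a * fnHom N q r (x N q r l) =
    fnHom N q r (x N q r l) * theta N q r a := by
  have key : ∀ i j, ∑ k, ∑ l, Rhat q k l i j • ∑ a, fnHom N q r (sphN N q k a) *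
      (theta N q r a * fnHom N q r (x N q r l) - fnHom N q r (x N q r l) * theta N q r a) = 0 := by
    intro i j
    have hA : ∑ k, ∑ l, Rhat q k l i j • ∑ a, fnHom N q r (sphN N q k a) *
        (theta N q r a * fnHom N q r (x N q r l)) =
        Lam N q r • (fnHom N q r (x N q r i) * xi N q r j) := by
      simp only [← mul_assoc, ← Finset.sum_mul, hG.sphN_theta, smul_mul_assoc, x_mul_xi,
        Finset.smul_sum]
      exact Finset.sum_congr rfl fun k _ => Finset.sum_congr rfl fun l _ => smul_comm _ _ _
    have hB : ∑ k, ∑ l, Rhat q k l i j • ∑ a, fnHom N q r (sphN N q k a) *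
        (fnHom N q r (x N q r l) * theta N q r a) =
        fnHom N q r (x N q r i) * ∑ a, fnHom N q r (sphN N q j a) * theta N q r a := by
      simp only [← mul_assoc, ← map_mul, Finset.mul_sum, hG.x_mul_sphN, map_sum, map_smul,
        Finset.sum_mul, smul_mul_assoc, Finset.smul_sum]
      conv_lhs => enter [2, k]; rw [Finset.sum_comm]
      rw [Finset.sum_comm]
    simp only [mul_sub, Finset.sum_sub_distrib, smul_sub]
    rw [hA, hB, hG.sphN_theta, mul_smul_comm, sub_self]
  have h2 := fun k => eq_zero_of_sum_Rhat_smul hG.q_ne hG.three_ne hG.four_ne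
    (fun k l => ∑ a, fnHom N q r (sphN N q k a) *
      (theta N q r a * fnHom N q r (x N q r l) - fnHom N q r (x N q r l) * theta N q r a)) key k l
  exact sub_eq_zero.1 (hG.eq_zero_of_sphN_mul (fnHom N q r) _ h2 a)

/-- The `x_i` generate the `q`-deformed fuzzy sphere. -/
lemma sphere_induction {P : Sphere N q → Prop} (h_alg : ∀ c, P (algebraMap ℂ _ c))
    (h_x : ∀ i, P (x N q r i)) (h_add : ∀ f h, P f → P h → P (f + h))
    (h_mul : ∀ f h, P f → P h → P (f * h)) (f : Sphere N q) : P f := by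
  obtain ⟨f, hf⟩ := f
  induction hf using Algebra.adjoin_induction with
  | mem f hf =>
    obtain ⟨i, rfl⟩ := hf
    have hc : (r * q ^ (N + 2) * csqrt (qnum 2 q) / rootNN N q) ≠ 0 :=
      div_ne_zero (mul_ne_zero (mul_ne_zero hG.r_ne (pow_ne_zero _ hG.q_ne))
        (csqrt_ne_zero hG.two_ne)) hG.root_ne
    have := h_mul _ _ (h_alg (r * q ^ (N + 2) * csqrt (qnum 2 q) / rootNN N q)⁻¹) (h_x i)
    rw [← Algebra.smul_def, x, smul_smul, inv_mul_cancel₀ hc, one_smul] at this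
    exact this
  | algebraMap c => exact h_alg c
  | add f h hf hh h1 h2 => exact h_add _ _ h1 h2
  | mul f h hf hh h1 h2 => exact h_mul _ _ h1 h2

lemma theta_mul_fn (a : Fin 3) (f : Sphere N q) : theta N q r a * fnHom N q r f =
    fnHom N q r f * theta N q r a := by
  refine hG.sphere_induction (P := fun f => theta N q r a * fnHom N q r f =
    fnHom N q r f * theta N q r a) (fun c => ?_) (hG.theta_mul_x a) (fun f h hf hh => ?_)
    (fun f h hf hh => ?_) f
  · rw [AlgHom.commutes, Algebra.commutes]
  · rw [map_add, mul_add, add_mul, hf, hh]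
  · rw [map_mul, ← mul_assoc, hf, mul_assoc, hh, mul_assoc]

/-- `ξ_i ξ_j` in the frame. -/
lemma smul_xi_mul_xi (i j : Fin 3) : Lam N q r ^ 2 • (xi N q r i * xi N q r j) =
    ∑ a, ∑ b, fnHom N q r (sphN N q i a * sphN N q j b) * (theta N q r a * theta N q r b) := by
  rw [sq, ← smul_mul_smul_comm, ← hG.sphN_theta, ← hG.sphN_theta, Finset.sum_mul_sum]
  refine Finset.sum_congr rfl fun a _ => Finset.sum_congr rfl fun b _ => ?_
  rw [map_mul, mul_assoc, ← mul_assoc (theta N q r a), hG.theta_mul_fn]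
  simp only [mul_assoc]

lemma sum_Rhat_sphN_sphN (i j a b : Fin 3) :
    ∑ k, ∑ l, Rhat q k l i j • (sphN N q k a * sphN N q l b) =
      ∑ c, ∑ d, Rhat q d c b a • (sphN N q i c * sphN N q j d) :=
  hG.borel.sum_Rhat_nMat_nMat hG.q_ne hG.sq_ne hG.three_ne hG.four_ne i j a b

omit hG in
lemma sum4_comm {M : Type*} [AddCommMonoid M] (f : Fin 3 → Fin 3 → Fin 3 → Fin 3 → M) :
    ∑ i, ∑ j, ∑ k, ∑ l, f i j k l = ∑ k, ∑ l, ∑ i, ∑ j, f i j k l := by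
  have := Finset.sum_comm (s := (Finset.univ : Finset (Fin 3 × Fin 3)))
    (t := (Finset.univ : Finset (Fin 3 × Fin 3))) (f := fun p t => f p.1 p.2 t.1 t.2)
  simpa only [Fintype.sum_prod_type] using this

/-- The `RLL` relation, contracted with elements of an algebra over the sphere. -/
lemma sum_sphN_sphN_mul {B : Type*} [Ring B] [Algebra ℂ B] (φ : Sphere N q →ₐ[ℂ] B)
    (E : Fin 3 → Fin 3 → B) (i j : Fin 3) :
    ∑ k, ∑ l, Rhat q k l i j • ∑ a, ∑ b, φ (sphN N q k a * sphN N q l b) * E a b =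
      ∑ c, ∑ d, φ (sphN N q i c * sphN N q j d) * ∑ a, ∑ b, Rhat q d c b a • E a b := by
  have h1 : ∑ k, ∑ l, Rhat q k l i j • ∑ a, ∑ b, φ (sphN N q k a * sphN N q l b) * E a b =
      ∑ a, ∑ b, φ (∑ k, ∑ l, Rhat q k l i j • (sphN N q k a * sphN N q l b)) * E a b := by
    simp only [map_sum, map_smul, Finset.sum_mul, smul_mul_assoc, Finset.smul_sum]
    rw [sum4_comm]
  rw [h1]
  simp only [hG.sum_Rhat_sphN_sphN, map_sum, map_smul, Finset.sum_mul, Finset.mul_sum,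
    smul_mul_assoc, mul_smul_comm]
  rw [sum4_comm]

/-- The RLL relation moves `R̂` from the `ξ`-indices to the frame indices, where the order is
reversed; the two factors `N` are then cancelled one after the other. -/
lemma theta_mul_theta (a b : Fin 3) : theta N q r a * theta N q r b =
    (-q ^ 2) • ∑ c, ∑ d, Rhat q b a c d • (theta N q r d * theta N q r c) := by
  have key : ∀ i j, ∑ c, fnHom N q r (sphN N q i c) * ∑ d, fnHom N q r (sphN N q j d) *
      (theta N q r c * theta N q r d - (-q ^ 2) • ∑ a, ∑ b, Rhat q d c b a •
        (theta N q r a * theta N q r b)) = 0 := by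
    intro i j
    have h1 := congrArg (Lam N q r ^ 2 • ·) (xi_mul_xi N q r i j)
    simp only [smul_comm (Lam N q r ^ 2) (-q ^ 2), Finset.smul_sum (r := Lam N q r ^ 2),
      smul_comm (Lam N q r ^ 2) (Rhat q _ _ _ _), hG.smul_xi_mul_xi] at h1
    rw [hG.sum_sphN_sphN_mul (fnHom N q r) (fun a b => theta N q r a * theta N q r b)] at h1
    rw [← sub_eq_zero] at h1
    rw [← h1]
    simp only [mul_sub, Finset.sum_sub_distrib, mul_smul_comm (-q ^ 2),
      ← Finset.smul_sum (r := -q ^ 2)]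
    simp only [map_mul, mul_assoc, Finset.mul_sum, mul_smul_comm]
  have h2 : ∀ c d, theta N q r c * theta N q r d - (-q ^ 2) • ∑ a, ∑ b, Rhat q d c b a •
        (theta N q r a * theta N q r b) = 0 := by
    intro c d
    refine hG.eq_zero_of_sphN_mul (fnHom N q r) (fun d => theta N q r c * theta N q r d -
      (-q ^ 2) • ∑ a, ∑ b, Rhat q d c b a • (theta N q r a * theta N q r b)) (fun j => ?_) d
    exact hG.eq_zero_of_sphN_mul (fnHom N q r) (fun c => ∑ d, fnHom N q r (sphN N q j d) *
      (theta N q r c * theta N q r d - (-q ^ 2) • ∑ a, ∑ b, Rhat q d c b a •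
        (theta N q r a * theta N q r b))) (fun i => key i j) c
  rw [Finset.sum_comm]
  exact sub_eq_zero.1 (h2 a b)

/-- `λ_a` as a multiple of the vector `y_i L^i_a`. -/
lemma lam_eq (a : Fin 3) : lam N q r a = (qnum 2 (q ^ (N + 1)))⁻¹ •
    muVec q (sphA N q) (jK N q) (sphD N q) (sphF N q) (sphG N q) a := by
  have h1 := hG.r_ne
  have h2 := hG.root_ne
  have h3 := hG.top_ne
  simp only [lam, muVec, ← jKinv_eq, x_eq hG.q_ne hG.two_ne, lplus_eq hG.q_ne hG.two_ne,
    smul_mul_assoc, ← Finset.smul_sum, smul_smul, Lam]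
  congr 1
  field_simp

lemma rootNN_sq : rootNN N q ^ 2 = qnum 2 q ^ 2 * sphC N q := by
  rw [rootNN, sq, csqrt_mul_self, sphC, mul_div_cancel₀ _ (pow_ne_zero 2 hG.two_ne)]

/-- By `rootNN_sq` the constant `[2]_q² C` of `g_muVec` is `[N]_q [N+2]_q`; divided by
`[2]_{q^{N+1}}²` it equals `r² / Λ_N²`. -/
lemma g_lam_lam : ∑ a, ∑ b, g q b a • (lam N q r a * lam N q r b) =
    algebraMap ℂ (Sphere N q) ((r : ℂ) ^ 2 / (q ^ 4 * Lam N q r ^ 2)) := by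
  have h := (sphereRel (N := N) hG.q_ne hG.two_ne).g_muVec hG.q_ne hG.sq_ne
  have h1 := hG.r_ne
  have h2 := hG.root_ne
  have h3 := hG.top_ne
  have h4 := hG.q_ne
  simp only [hG.lam_eq, smul_mul_smul_comm, smul_comm (g q _ _), ← Finset.smul_sum]
  rw [h, Algebra.algebraMap_eq_smul_one, Algebra.algebraMap_eq_smul_one, smul_smul]
  congr 1
  rw [Lam, div_pow, mul_pow, hG.rootNN_sq]
  have h5 : sphC N q ≠ 0 := by
    intro h0
    have := hG.rootNN_sq
    rw [h0, mul_zero] at this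
    exact pow_ne_zero 2 h2 this
  have h6 := hG.two_ne
  field_simp

lemma eps_lam_lam (c : Fin 3) : ∑ a, ∑ b, eps q b a c • (lam N q r a * lam N q r b) =
    (-(q ^ 2)⁻¹) • lam N q r c := by
  have h := (sphereRel (N := N) hG.q_ne hG.two_ne).eps_muVec hG.q_ne hG.sq_ne c
  have h2 := hG.two_ne
  have h3 := hG.top_ne
  have h4 := hG.q_ne
  simp only [hG.lam_eq, smul_mul_smul_comm, smul_comm (eps q _ _ _), ← Finset.smul_sum]
  rw [h, smul_smul, smul_smul, sphA]
  congr 1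
  field_simp

/-- Because `g^{ij} N_{ja} = L⁺^i_a`, the contraction `x_i g^{ij} ξ_j` becomes `Λ_N⁻¹ x_i L⁺^i_a
θ^a`. -/
lemma Theta_eq : Theta N q r = ∑ a, fnHom N q r (lam N q r a) * theta N q r a := by
  have hL : ∀ i a, ∑ j, g q i j • sphN N q j a = Lplus N q i a := fun i a => by
    rw [lplus_eq hG.q_ne hG.two_ne]
    exact BorelRel.sum_g_nMat hG.q_ne i a
  have h1 : ∀ i, ∑ j, g q i j • (fnHom N q r (x N q r i) * xi N q r j) =
      (Lam N q r)⁻¹ • ∑ a, fnHom N q r (x N q r i * Lplus N q i a) * theta N q r a := by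
    intro i
    simp only [hG.xi_eq, ← hL, mul_smul_comm, smul_comm (g q i _), ← Finset.smul_sum, map_mul,
      map_sum, map_smul, Finset.mul_sum, Finset.sum_mul, smul_mul_assoc, mul_assoc]
    congr 1
    simp only [Finset.smul_sum]
    rw [Finset.sum_comm]
  simp only [Theta, fn_eq, h1, lam, map_smul, map_sum, smul_mul_assoc, Finset.sum_mul,
    ← Finset.smul_sum]
  rw [Finset.sum_comm]

end Generic
end forms

/-! ### The cube of `Θ` as volume form. -/

section forms

variable {N : ℕ} {q : ℂ} {r : ℝ} (hG : Generic N q r)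
include hG

namespace Generic

lemma frame_sum_mul (c d : Fin 3 → Sphere N q) :
    (∑ a, fnHom N q r (c a) * theta N q r a) * (∑ b, fnHom N q r (d b) * theta N q r b) =
      ∑ a, ∑ b, fnHom N q r (c a * d b) * (theta N q r a * theta N q r b) := by
  rw [Finset.sum_mul_sum]
  refine Finset.sum_congr rfl fun a _ => Finset.sum_congr rfl fun b _ => ?_
  rw [map_mul, mul_assoc, ← mul_assoc (theta N q r a), hG.theta_mul_fn]
  simp only [mul_assoc]

lemma frame_sum_mul_mul (c d e : Fin 3 → Sphere N q) :
    (∑ a, fnHom N q r (c a) * theta N q r a) * (∑ b, fnHom N q r (d b) * theta N q r b) *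
      (∑ a, fnHom N q r (e a) * theta N q r a) =
      ∑ a, ∑ b, ∑ i, fnHom N q r (c a * d b * e i) *
        (theta N q r a * theta N q r b * theta N q r i) := by
  rw [hG.frame_sum_mul, Finset.sum_mul]
  refine Finset.sum_congr rfl fun a _ => ?_
  rw [Finset.sum_mul]
  refine Finset.sum_congr rfl fun b _ => ?_
  rw [Finset.mul_sum]
  refine Finset.sum_congr rfl fun i _ => ?_
  rw [map_mul _ (c a * d b), mul_assoc, mul_assoc, mul_assoc, mul_assoc,
    ← mul_assoc (theta N q r b) (fnHom N q r (e i)), hG.theta_mul_fn, mul_assoc,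
    ← mul_assoc (theta N q r a), hG.theta_mul_fn, mul_assoc]

/-- The `ε`-contraction of two factors gives `-q⁻² λ_n`, and the `g`-contraction of this with the
third factor is the radius relation. The result is a nonzero scalar, so `V` can be recovered from
`Θ³`. -/
lemma epsUp_lam : ∑ a, ∑ b, ∑ c, epsUp q c b a • (lam N q r a * lam N q r b * lam N q r c) =
    algebraMap ℂ (Sphere N q) (-((r : ℂ) ^ 2 / (q ^ 6 * Lam N q r ^ 2))) := by
  have h1 : ∑ c, ∑ n, g q c n • ((∑ a, ∑ b, eps q b a n • (lam N q r a * lam N q r b)) *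
      lam N q r c) = ∑ a, ∑ b, ∑ c, epsUp q c b a •
        (lam N q r a * lam N q r b * lam N q r c) := by
    simp only [epsUp, Finset.sum_smul, Finset.sum_mul, Finset.smul_sum, smul_mul_assoc, smul_smul]
    rw [sum4_comm]
  rw [← h1]
  simp only [hG.eps_lam_lam, smul_mul_assoc, smul_comm (g q _ _), ← Finset.smul_sum]
  rw [Finset.sum_comm, hG.g_lam_lam, Algebra.algebraMap_eq_smul_one,
    Algebra.algebraMap_eq_smul_one, smul_smul]
  congr 1
  have := hG.q_ne
  have := hG.Lam_ne
  field_simp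

lemma Theta_cube_eq {V : Forms N q r}
    (hV : ∀ a b c, theta N q r a * theta N q r b * theta N q r c = epsUp q c b a • V) :
    Theta N q r ^ 3 = (-((r : ℂ) ^ 2 / (q ^ 6 * Lam N q r ^ 2))) • V := by
  rw [pow_succ, sq, hG.Theta_eq, hG.frame_sum_mul_mul]
  simp only [hV, mul_smul_comm, ← smul_mul_assoc, ← Finset.sum_mul, ← map_smul, ← map_sum]
  simp only [smul_mul_assoc]
  rw [hG.epsUp_lam, AlgHom.commutes, Algebra.smul_def]

lemma theta_mul_theta_mul_theta (a b c : Fin 3) :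
    theta N q r a * theta N q r b * theta N q r c =
      (-(Lam N q r ^ 2 * q ^ 6 / (r : ℂ) ^ 2) * epsUp q c b a) • Theta N q r ^ 3 := by
  obtain ⟨V, hV⟩ := frame_mul_mul hG.q_ne hG.sq_ne hG.three_ne hG.four_ne hG.theta_mul_theta
  rw [hG.Theta_cube_eq hV, hV, smul_smul]
  congr 1
  have := hG.q_ne
  have := hG.Lam_ne
  have := hG.r_ne
  field_simp

end Generic
end forms

/-! ### A model of the calculus -/

section model

variable (S : Type*) [Ring S] [Algebra ℂ S] (q : ℂ)

/-- The free module on a basis `1`, `θ^a`, `η^n`, `V` of the exterior algebra of the frame. -/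
abbrev Model : Type _ := S × (Fin 3 → S) × (Fin 3 → S) × S

/-- Left multiplication by functions. -/
noncomputable def modelFn : S →ₐ[ℂ] Module.End ℂ (Model S) := Algebra.lsmul ℂ ℂ (Model S)

variable {S}

lemma modelFn_apply (f : S) (v : Model S) : modelFn S f v =
    (f * v.1, (fun n => f * v.2.1 n), (fun n => f * v.2.2.1 n), f * v.2.2.2) := rfl

variable (S)

/-- Left multiplication by `θ^a`. -/
noncomputable def modelTheta (a : Fin 3) : Module.End ℂ (Model S) where
  toFun v := (0, Pi.single a v.1, fun n => ∑ c, eps q c a n • v.2.1 c, ∑ n, g q n a • v.2.2.1 n)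
  map_add' v w := by
    simp [Pi.single_add, Finset.sum_add_distrib, funext_iff]
  map_smul' t v := by
    simp [Pi.single_smul, Finset.smul_sum, funext_iff, smul_comm t]

/-- Left multiplication by `η^n`. -/
noncomputable def modelEta (n : Fin 3) : Module.End ℂ (Model S) where
  toFun v := (0, 0, Pi.single n v.1, ∑ c, g q c n • v.2.1 c)
  map_add' v w := by
    simp [Pi.single_add, Finset.sum_add_distrib]
  map_smul' t v := by
    simp [Pi.single_smul, Finset.smul_sum, smul_comm t]

variable {q}

lemma modelTheta_apply (a : Fin 3) (v : Model S) : modelTheta S q a v =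
    (0, Pi.single a v.1, fun n => ∑ c, eps q c a n • v.2.1 c, ∑ n, g q n a • v.2.2.1 n) := rfl

lemma modelEta_apply (n : Fin 3) (v : Model S) : modelEta S q n v =
    (0, 0, Pi.single n v.1, ∑ c, g q c n • v.2.1 c) := rfl

variable {S}

lemma modelTheta_mul_modelFn (a : Fin 3) (f : S) :
    modelTheta S q a * modelFn S f = modelFn S f * modelTheta S q a := by
  refine LinearMap.ext fun v => ?_
  simp only [Module.End.mul_apply, modelTheta_apply, modelFn_apply]
  refine Prod.ext ?_ (Prod.ext ?_ (Prod.ext ?_ ?_))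
  · simp
  · ext n
    simp [Pi.single_apply]
  · ext n
    simp [Finset.mul_sum]
  · simp [Finset.mul_sum]

/-- The only nontrivial component is the action on degree one, where `θ^a (θ^b θ^c)` meets `(θ^a
θ^b) θ^c`; they agree by `g_eps_cyclic`. -/
lemma modelTheta_mul (hq : q ≠ 0) (a b : Fin 3) :
    modelTheta S q a * modelTheta S q b = ∑ n, eps q b a n • modelEta S q n := by
  refine LinearMap.ext fun v => ?_
  simp only [Module.End.mul_apply, modelTheta_apply, modelEta_apply, LinearMap.sum_apply,
    LinearMap.smul_apply]
  refine Prod.ext ?_ (Prod.ext ?_ (Prod.ext ?_ ?_))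
  · simp [Prod.fst_sum]
  · simp [Prod.fst_sum, Prod.snd_sum]
  · ext n
    simp [Prod.fst_sum, Prod.snd_sum, Pi.single_apply]
  · simp only [Prod.snd_sum, Prod.smul_snd, Finset.smul_sum, smul_smul]
    rw [Finset.sum_comm]
    conv_rhs => rw [Finset.sum_comm]
    refine Finset.sum_congr rfl fun c _ => ?_
    simp only [← Finset.sum_smul]
    congr 1
    simp only [mul_comm (eps q b a _), g_eps_cyclic q hq a b c]
    simp only [mul_comm]

/-- The array `ε^{ba}_n η^n` is an eigenvector of `R̂` with eigenvalue `-q⁻²`, hence fixed by `-q²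
R̂`. -/
lemma modelTheta_mul_rel (hq : q ≠ 0) (h3 : qnum 3 q ≠ 0) (h4 : qnum 2 (q ^ 2) ≠ 0)
    (a b : Fin 3) : modelTheta S q a * modelTheta S q b =
      (-q ^ 2) • ∑ c, ∑ d, Rhat q b a c d • (modelTheta S q d * modelTheta S q c) := by
  simp only [modelTheta_mul hq, Rhat_symm hq h3 h4 b a]
  rw [sum_Rhat_smul hq h3 h4 (fun k l => ∑ n, eps q k l n • modelEta S q n)]
  simp only [eps_smul_eps_smul hq (fun n => modelEta S q n),
    g_smul_eps_smul hq (fun n => modelEta S q n), smul_zero, add_zero,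
    smul_comm (eps q b a _) (qnum 2 (q ^ 2)), ← Finset.smul_sum]
  rw [← sub_smul, smul_smul, qnum_two]
  nth_rewrite 1 [← one_smul ℂ (∑ n, eps q b a n • modelEta S q n)]
  congr 1
  field_simp
  ring

end model

/-! ### The calculus acting on the model, and freeness. -/

section forms

variable {N : ℕ} {q : ℂ} {r : ℝ} (hG : Generic N q r)
include hG

namespace Generic

/-- The images of the `ξ_i` in the model. -/
noncomputable def modelXi (N : ℕ) (q : ℂ) (r : ℝ) (j : Fin 3) :
    Module.End ℂ (Model (Sphere N q)) :=
  (Lam N q r)⁻¹ • ∑ a, modelFn _ (sphN N q j a) * modelTheta _ q a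

lemma modelFn_x_mul_modelXi (i j : Fin 3) :
    modelFn _ (x N q r i) * modelXi N q r j = ∑ k, ∑ l, Rhat q k l i j •
      (modelXi N q r k * modelFn _ (x N q r l)) := by
  simp only [modelXi, smul_mul_assoc, mul_smul_comm, smul_comm (Rhat q _ _ _ _) (Lam N q r)⁻¹,
    ← Finset.smul_sum]
  congr 1
  simp only [Finset.mul_sum, Finset.sum_mul, mul_assoc, modelTheta_mul_modelFn]
  simp only [← mul_assoc, ← map_mul, hG.x_mul_sphN, map_sum, map_smul, Finset.sum_mul,
    smul_mul_assoc, Finset.smul_sum]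
  conv_rhs => enter [2, k]; rw [Finset.sum_comm]
  rw [Finset.sum_comm]

omit hG in
lemma modelXi_mul_modelXi_eq (i j : Fin 3) : modelXi N q r i * modelXi N q r j =
    ((Lam N q r)⁻¹ * (Lam N q r)⁻¹) • ∑ a, ∑ b,
      modelFn _ (sphN N q i a * sphN N q j b) * (modelTheta _ q a * modelTheta _ q b) := by
  rw [modelXi, modelXi, smul_mul_smul_comm, Finset.sum_mul_sum]
  congr 1
  refine Finset.sum_congr rfl fun a _ => Finset.sum_congr rfl fun b _ => ?_
  rw [map_mul, mul_assoc, ← mul_assoc (modelTheta _ q a), modelTheta_mul_modelFn]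
  simp only [mul_assoc]

lemma modelXi_mul_modelXi (i j : Fin 3) : modelXi N q r i * modelXi N q r j =
    (-q ^ 2) • ∑ k, ∑ l, Rhat q k l i j • (modelXi N q r k * modelXi N q r l) := by
  simp only [modelXi_mul_modelXi_eq, smul_comm (Rhat q _ _ _ _) ((Lam N q r)⁻¹ * (Lam N q r)⁻¹),
    ← Finset.smul_sum]
  rw [hG.sum_sphN_sphN_mul (modelFn (Sphere N q))
    (fun a b => modelTheta (Sphere N q) q a * modelTheta (Sphere N q) q b), smul_comm]
  congr 1
  rw [Finset.smul_sum]
  refine Finset.sum_congr rfl fun a _ => ?_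
  rw [Finset.smul_sum]
  refine Finset.sum_congr rfl fun b _ => ?_
  rw [modelTheta_mul_rel hG.q_ne hG.three_ne hG.four_ne, Finset.sum_comm, mul_smul_comm]

/-- The representation of the calculus on the model. -/
noncomputable def modelHom : Forms N q r →ₐ[ℂ] Module.End ℂ (Model (Sphere N q)) :=
  RingQuot.liftAlgHom ℂ ⟨FreeAlgebra.lift ℂ (Sum.elim (modelFn _) (modelXi N q r)), by
    intro u v huv
    induction huv with
    | add f h => simp
    | mul f h => simp
    | scalar c => simp
    | braid i j => simpa using hG.modelFn_x_mul_modelXi i j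
    | ext i j =>
      simp only [map_mul, map_smul, map_sum, FreeAlgebra.lift_ι_apply, Sum.elim_inr]
      exact hG.modelXi_mul_modelXi i j⟩

lemma modelHom_fn (f : Sphere N q) : hG.modelHom (fnHom N q r f) = modelFn _ f := by
  rw [← fn_eq, fn, modelHom, RingQuot.liftAlgHom_mkAlgHom_apply]
  simp

lemma modelHom_xi (i : Fin 3) : hG.modelHom (xi N q r i) = modelXi N q r i := by
  rw [xi, modelHom, RingQuot.liftAlgHom_mkAlgHom_apply]
  simp

lemma modelHom_theta (a : Fin 3) : hG.modelHom (theta N q r a) = modelTheta _ q a := by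
  rw [hG.theta_eq, map_smul, map_sum]
  simp only [map_mul, hG.modelHom_fn, hG.modelHom_xi, modelXi, mul_smul_comm, ← Finset.smul_sum]
  rw [smul_smul, mul_inv_cancel₀ hG.Lam_ne, one_smul]
  simp only [Finset.mul_sum, ← mul_assoc, ← map_mul]
  rw [Finset.sum_comm]
  simp only [← Finset.sum_mul, ← map_sum, hG.sphW_mul_sphN]
  simp

/-- The `θ^a` are linearly independent over the functions. -/
lemma frame_injective {c d : Fin 3 → Sphere N q}
    (h : ∑ a, fnHom N q r (c a) * theta N q r a = ∑ a, fnHom N q r (d a) * theta N q r a) :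
    c = d := by
  -- Applied to the vacuum `(1, 0, 0, 0)`, a one-form shows its coefficients in the degree-one
  -- component.
  have key : ∀ c : Fin 3 → Sphere N q,
      (hG.modelHom (∑ a, fnHom N q r (c a) * theta N q r a) (1, 0, 0, 0)).2.1 = c := by
    intro c
    simp only [map_sum, map_mul, hG.modelHom_fn, hG.modelHom_theta, LinearMap.sum_apply,
      Module.End.mul_apply, modelTheta_apply, modelFn_apply]
    ext n
    simp [Prod.fst_sum, Prod.snd_sum, Pi.single_apply]
  rw [← key c, h, key d]

lemma theta_volume_injective {f h : Sphere N q}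
    (hfh : fnHom N q r f * (theta N q r 0 * theta N q r 1 * theta N q r 2) =
      fnHom N q r h * (theta N q r 0 * theta N q r 1 * theta N q r 2)) : f = h := by
  -- On the vacuum, `θ^1 θ^0 θ^{-1}` gives `q² V`, as `ε^{-1,0,1} = q²`.
  have key : ∀ f : Sphere N q, (hG.modelHom (fnHom N q r f *
      (theta N q r 0 * theta N q r 1 * theta N q r 2)) (1, 0, 0, 0)).2.2.2 = q ^ 2 • f := by
    intro f
    simp only [map_mul, hG.modelHom_fn, hG.modelHom_theta, Module.End.mul_apply,
      modelTheta_apply, modelFn_apply]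
    simp [Fin.sum_univ_three, eps, g, Pi.single_apply, smul_smul, sq]
  have h1 := key f
  rw [hfh, key h] at h1
  exact (smul_right_injective _ (pow_ne_zero 2 hG.q_ne) h1).symm

end Generic
end forms

/-! ### Forms of degree one and three in the frame. -/

section forms

variable {N : ℕ} {q : ℂ} {r : ℝ}

lemma xi_mul_fn_mem (i : Fin 3) (f : Sphere N q) :
    xi N q r i * fnHom N q r f ∈ formsDeg N q r 1 :=
  Submodule.subset_span ⟨(fun _ => i, f), by simp [fn_eq]⟩

lemma xi_mul_xi_mul_fn_mem (i j : Fin 3) (f : Sphere N q) :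
    xi N q r i * (xi N q r j * fnHom N q r f) ∈ formsDeg N q r 2 :=
  Submodule.subset_span ⟨(![i, j], f), by simp [fn_eq, List.ofFn_succ, mul_assoc]⟩

lemma xi_mem (i : Fin 3) : xi N q r i ∈ formsDeg N q r 1 := by
  simpa using xi_mul_fn_mem (r := r) i (1 : Sphere N q)

lemma formsDeg_one_le (P : Submodule ℂ (Forms N q r))
    (h : ∀ i f, xi N q r i * fnHom N q r f ∈ P) : formsDeg N q r 1 ≤ P := by
  refine Submodule.span_le.2 ?_
  rintro _ ⟨p, rfl⟩
  simpa [fn_eq] using h (p.1 0) p.2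

lemma formsDeg_three_le (P : Submodule ℂ (Forms N q r))
    (h : ∀ i j k f, xi N q r i * xi N q r j * xi N q r k * fnHom N q r f ∈ P) :
    formsDeg N q r 3 ≤ P := by
  refine Submodule.span_le.2 ?_
  rintro _ ⟨p, rfl⟩
  simpa [fn_eq, List.ofFn_succ, mul_assoc] using h (p.1 0) (p.1 1) (p.1 2) p.2

variable (hG : Generic N q r)
include hG

namespace Generic

/-- The degree-one span has functions on the right only. A generator `x_i` on the left is carried
through `ξ_j` by the braiding, and `sphere_induction` extends this to all functions. -/
lemma fn_mul_mem (f : Sphere N q) : ∀ α ∈ formsDeg N q r 1,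
    fnHom N q r f * α ∈ formsDeg N q r 1 := by
  refine hG.sphere_induction (P := fun f => ∀ α ∈ formsDeg N q r 1,
    fnHom N q r f * α ∈ formsDeg N q r 1) (fun c α hα => ?_) (fun i α hα => ?_)
    (fun f h hf hh α hα => ?_) (fun f h hf hh α hα => ?_) f
  · rw [AlgHom.commutes, ← Algebra.smul_def]
    exact Submodule.smul_mem _ _ hα
  · refine formsDeg_one_le ((formsDeg N q r 1).comap
      (LinearMap.mulLeft ℂ (fnHom N q r (x N q r i)))) (fun j h => ?_) hα
    rw [Submodule.mem_comap, LinearMap.mulLeft_apply, ← mul_assoc, x_mul_xi]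
    simp only [Finset.sum_mul, smul_mul_assoc, mul_assoc, ← map_mul]
    exact Submodule.sum_mem _ fun k _ => Submodule.sum_mem _ fun l _ =>
      Submodule.smul_mem _ _ (xi_mul_fn_mem _ _)
  · rw [map_add, add_mul]
    exact Submodule.add_mem _ (hf α hα) (hh α hα)
  · rw [map_mul, mul_assoc]
    exact hf _ (hh α hα)

lemma mul_mem_two {α β : Forms N q r} (hα : α ∈ formsDeg N q r 1) (hβ : β ∈ formsDeg N q r 1) :
    α * β ∈ formsDeg N q r 2 := by
  refine formsDeg_one_le ((formsDeg N q r 2).comap (LinearMap.mulRight ℂ β)) (fun i f => ?_) hα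
  rw [Submodule.mem_comap, LinearMap.mulRight_apply, mul_assoc]
  refine formsDeg_one_le ((formsDeg N q r 2).comap (LinearMap.mulLeft ℂ (xi N q r i)))
    (fun j h => ?_) (hG.fn_mul_mem f β hβ)
  exact xi_mul_xi_mul_fn_mem i j h

lemma theta_mem (a : Fin 3) : theta N q r a ∈ formsDeg N q r 1 := by
  rw [hG.theta_eq]
  exact Submodule.smul_mem _ _ (Submodule.sum_mem _ fun k _ => hG.fn_mul_mem _ _ (xi_mem k))

/-- One-forms in terms of their components with respect to the frame. -/
noncomputable def frameMap (_ : Generic N q r) : (Fin 3 → Sphere N q) →ₗ[ℂ] Forms N q r :=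
  ∑ a, (LinearMap.mulRight ℂ (theta N q r a)) ∘ₗ (fnHom N q r).toLinearMap ∘ₗ LinearMap.proj a

lemma frameMap_apply (c : Fin 3 → Sphere N q) :
    hG.frameMap c = ∑ a, fnHom N q r (c a) * theta N q r a := by
  simp [frameMap]

lemma range_frameMap : LinearMap.range hG.frameMap = formsDeg N q r 1 := by
  refine le_antisymm ?_ (formsDeg_one_le _ fun i f => ?_)
  · rintro _ ⟨c, rfl⟩
    rw [hG.frameMap_apply]
    exact Submodule.sum_mem _ fun a _ => hG.fn_mul_mem _ _ (hG.theta_mem a)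
  · refine ⟨(Lam N q r)⁻¹ • fun a => sphN N q i a * f, ?_⟩
    rw [map_smul, hG.frameMap_apply, hG.xi_eq, smul_mul_assoc, Finset.sum_mul]
    congr 1
    refine Finset.sum_congr rfl fun a _ => ?_
    rw [map_mul, mul_assoc, mul_assoc, hG.theta_mul_fn]

lemma frameMap_injective : Function.Injective hG.frameMap := fun c d h => by
  rw [hG.frameMap_apply, hG.frameMap_apply] at h
  exact hG.frame_injective h

/-- The frame as an isomorphism onto the one-forms. -/
noncomputable def frameEquiv : (Fin 3 → Sphere N q) ≃ₗ[ℂ] formsDeg N q r 1 :=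
  (LinearEquiv.ofInjective hG.frameMap hG.frameMap_injective).trans
    (LinearEquiv.ofEq _ _ hG.range_frameMap)

lemma coe_frameEquiv (c : Fin 3 → Sphere N q) :
    (hG.frameEquiv c : Forms N q r) = ∑ a, fnHom N q r (c a) * theta N q r a := by
  rw [← hG.frameMap_apply]
  rfl

lemma existsUnique_frame {α : Forms N q r} (hα : α ∈ formsDeg N q r 1) :
    ∃! c : Fin 3 → Sphere N q, α = ∑ a, fn N q r (c a) * theta N q r a := by
  obtain ⟨c, hc⟩ := hG.frameEquiv.surjective ⟨α, hα⟩
  have hc' := congrArg Subtype.val hc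
  rw [coe_frameEquiv] at hc'
  refine ⟨c, hc'.symm, fun d hd => hG.frame_injective ?_⟩
  rw [hc']
  exact hd.symm

lemma existsUnique_volume {α : Forms N q r} (hα : α ∈ formsDeg N q r 3) :
    ∃! f : Sphere N q, α = fn N q r f * Theta N q r ^ 3 := by
  have h1 : α ∈ LinearMap.range
      (LinearMap.mulRight ℂ (Theta N q r ^ 3) ∘ₗ (fnHom N q r).toLinearMap) := by
    refine formsDeg_three_le _ (fun i j k f => ?_) hα
    have hcomm : ∀ a b c, theta N q r a * theta N q r b * theta N q r c * fnHom N q r f =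
        fnHom N q r f * (theta N q r a * theta N q r b * theta N q r c) := by
      intro a b c
      rw [mul_assoc, hG.theta_mul_fn, ← mul_assoc, mul_assoc (theta N q r a), hG.theta_mul_fn,
        ← mul_assoc, hG.theta_mul_fn]
      simp only [mul_assoc]
    have hxi : ∀ j, xi N q r j =
        ∑ a, fnHom N q r ((Lam N q r)⁻¹ • sphN N q j a) * theta N q r a := by
      intro j
      rw [hG.xi_eq]
      simp only [map_smul, smul_mul_assoc, Finset.smul_sum]
    rw [hxi i, hxi j, hxi k, hG.frame_sum_mul_mul]
    simp only [Finset.sum_mul]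
    refine Submodule.sum_mem _ fun a _ => Submodule.sum_mem _ fun b _ => Submodule.sum_mem _
      fun c _ => ?_
    rw [mul_assoc, hcomm, ← mul_assoc, ← map_mul, hG.theta_mul_theta_mul_theta, mul_smul_comm]
    exact Submodule.smul_mem _ _ ⟨_, rfl⟩
  obtain ⟨f, hf⟩ := h1
  refine ⟨f, hf.symm, fun h hh => ?_⟩
  have e : fnHom N q r h * Theta N q r ^ 3 = fnHom N q r f * Theta N q r ^ 3 :=
    hh.symm.trans hf.symm
  -- The product `θ^1 θ^0 θ^{-1}` is a scalar multiple of `Θ³`, so equal multiples of `Θ³` have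
  -- equal coefficients there, where the model detects them.
  refine hG.theta_volume_injective ?_
  rw [hG.theta_mul_theta_mul_theta, mul_smul_comm, mul_smul_comm, e]

/-! ### The Hodge star -/

/-- The Hodge star of `θ^a`. -/
noncomputable def starTheta (N : ℕ) (q : ℂ) (r : ℝ) (a : Fin 3) : Forms N q r :=
  (-(q ^ 2 * qnum 2 (q ^ 2))⁻¹) • ∑ b, ∑ c, eps q b c a • (theta N q r c * theta N q r b)

lemma starTheta_mul_fn (a : Fin 3) (f : Sphere N q) :
    starTheta N q r a * fnHom N q r f = fnHom N q r f * starTheta N q r a := by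
  rw [starTheta, smul_mul_assoc, mul_smul_comm]
  simp only [Finset.sum_mul, Finset.mul_sum, smul_mul_assoc, mul_smul_comm, mul_assoc,
    hG.theta_mul_fn]
  simp only [← mul_assoc, hG.theta_mul_fn]

lemma fn_mul_starTheta_mem (f : Sphere N q) (a : Fin 3) :
    fnHom N q r f * starTheta N q r a ∈ formsDeg N q r 2 := by
  rw [starTheta, mul_smul_comm]
  simp only [Finset.mul_sum, mul_smul_comm, ← mul_assoc]
  exact Submodule.smul_mem _ _ (Submodule.sum_mem _ fun _ _ => Submodule.sum_mem _ fun _ _ =>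
    Submodule.smul_mem _ _ (hG.mul_mem_two (hG.fn_mul_mem _ _ (hG.theta_mem _)) (hG.theta_mem _)))

lemma sum_eps_sphN_sphN_mul {B : Type*} [Ring B] [Algebra ℂ B] (φ : Sphere N q →ₐ[ℂ] B)
    (E : Fin 3 → Fin 3 → B) (i : Fin 3) :
    ∑ j, ∑ k, eps q j k i • ∑ a, ∑ b, φ (sphN N q j a * sphN N q k b) * E a b =
      ∑ m, φ (sphN N q i m) * ∑ b, ∑ c, eps q b c m • E c b := by
  have h1 : ∑ j, ∑ k, eps q j k i • ∑ a, ∑ b, φ (sphN N q j a * sphN N q k b) * E a b =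
      ∑ a, ∑ b, φ (∑ j, ∑ k, eps q j k i • (sphN N q j a * sphN N q k b)) * E a b := by
    simp only [map_sum, map_smul, Finset.sum_mul, smul_mul_assoc, Finset.smul_sum]
    rw [sum4_comm]
  have h2 : ∀ a b, ∑ j, ∑ k, eps q j k i • (sphN N q j a * sphN N q k b) =
      ∑ m, eps q b a m • sphN N q i m := hG.borel.eps_nMat_nMat hG.q_ne hG.sq_ne i
  rw [h1]
  simp only [h2, map_sum, map_smul, Finset.sum_mul, smul_mul_assoc, mul_smul_comm, Finset.mul_sum]
  rw [Finset.sum_comm]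
  conv_lhs => enter [2, b]; rw [Finset.sum_comm]
  rw [Finset.sum_comm]

/-- The prescribed value of the Hodge star on `ξ_i`, in terms of the frame. -/
lemma star_xi (i : Fin 3) : (-((q ^ 2)⁻¹ * Lam N q r / qnum 2 (q ^ 2))) •
      ∑ j, ∑ k, eps q j k i • (xi N q r j * xi N q r k) =
    (Lam N q r)⁻¹ • ∑ a, fnHom N q r (sphN N q i a) * starTheta N q r a := by
  have h1 := hG.sum_eps_sphN_sphN_mul (fnHom N q r)
    (fun a b => theta N q r a * theta N q r b) i
  simp only [← hG.smul_xi_mul_xi, smul_comm (eps q _ _ _) (Lam N q r ^ 2),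
    ← Finset.smul_sum (r := Lam N q r ^ 2)] at h1
  have e : -((q ^ 2)⁻¹ * Lam N q r / qnum 2 (q ^ 2)) =
      (Lam N q r)⁻¹ * -(q ^ 2 * qnum 2 (q ^ 2))⁻¹ * Lam N q r ^ 2 := by
    have hq := hG.q_ne
    have h4 := hG.four_ne
    have hL := hG.Lam_ne
    field_simp
  rw [e, mul_smul, mul_smul, h1]
  simp only [starTheta]
  generalize -(q ^ 2 * qnum 2 (q ^ 2))⁻¹ = c
  simp only [mul_smul_comm c, ← Finset.smul_sum (r := c)]

/-- The Hodge star. -/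
noncomputable def star : formsDeg N q r 1 →ₗ[ℂ] formsDeg N q r 2 :=
  (LinearMap.codRestrict (formsDeg N q r 2)
    (∑ a, (LinearMap.mulRight ℂ (starTheta N q r a)) ∘ₗ (fnHom N q r).toLinearMap ∘ₗ
      LinearMap.proj a) (fun c => by
        simpa using Submodule.sum_mem _ fun a _ => hG.fn_mul_starTheta_mem (c a) a)) ∘ₗ
    hG.frameEquiv.symm.toLinearMap

lemma coe_star (c : Fin 3 → Sphere N q) :
    (hG.star (hG.frameEquiv c) : Forms N q r) = ∑ a, fnHom N q r (c a) * starTheta N q r a := by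
  simp [star]

lemma star_eq {α : formsDeg N q r 1} {c : Fin 3 → Sphere N q}
    (h : (α : Forms N q r) = ∑ a, fnHom N q r (c a) * theta N q r a) :
    (hG.star α : Forms N q r) = ∑ a, fnHom N q r (c a) * starTheta N q r a := by
  rw [← coe_star, show α = hG.frameEquiv c from Subtype.ext (h.trans (hG.coe_frameEquiv c).symm)]

/-- The map is left linear by construction. It is also right linear because `θ^a` and its image
`starTheta` both commute with functions. -/
lemma isHodgeStar_star : IsHodgeStar N q r hG.star where
  left f α β h := by
    obtain ⟨c, rfl⟩ := hG.frameEquiv.surjective α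
    rw [coe_frameEquiv, fn_eq] at h
    rw [hG.coe_star, hG.star_eq (c := fun a => f * c a), fn_eq]
    · simp only [Finset.mul_sum, map_mul, mul_assoc]
    · rw [h]
      simp only [Finset.mul_sum, map_mul, mul_assoc]
  right f α β h := by
    obtain ⟨c, rfl⟩ := hG.frameEquiv.surjective α
    rw [coe_frameEquiv, fn_eq] at h
    rw [hG.coe_star, hG.star_eq (c := fun a => c a * f), fn_eq]
    · simp only [Finset.sum_mul, map_mul, mul_assoc, hG.starTheta_mul_fn]
    · rw [h]
      simp only [Finset.sum_mul, map_mul, mul_assoc, hG.theta_mul_fn]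
  map_xi i α h := by
    rw [hG.star_xi, hG.star_eq (c := fun a => (Lam N q r)⁻¹ • sphN N q i a)]
    · simp only [map_smul, smul_mul_assoc, Finset.smul_sum]
    · rw [h, hG.xi_eq]
      simp only [map_smul, smul_mul_assoc, Finset.smul_sum]

/-- Left linearity and the values on `ξ_k` suffice: expanding `θ^a = Λ_N W_{ak} ξ_k`, the factor `W`
cancels the `N` in `star_xi`. -/
lemma hodgeStar_theta {H : formsDeg N q r 1 →ₗ[ℂ] formsDeg N q r 2} (hH : IsHodgeStar N q r H)
    (a : Fin 3) : (H ⟨theta N q r a, hG.theta_mem a⟩ : Forms N q r) = starTheta N q r a := by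
  have h1 : (⟨theta N q r a, hG.theta_mem a⟩ : formsDeg N q r 1) = Lam N q r • ∑ k,
      ⟨fnHom N q r (sphW N q a k) * xi N q r k, hG.fn_mul_mem _ _ (xi_mem k)⟩ := by
    apply Subtype.ext
    simp [hG.theta_eq a]
  have h2 : ∀ k, (H ⟨fnHom N q r (sphW N q a k) * xi N q r k, hG.fn_mul_mem _ _ (xi_mem k)⟩ :
      Forms N q r) = fnHom N q r (sphW N q a k) *
        ((Lam N q r)⁻¹ • ∑ b, fnHom N q r (sphN N q k b) * starTheta N q r b) := by
    intro k
    rw [hH.left (sphW N q a k) ⟨xi N q r k, xi_mem k⟩ _ rfl, hH.map_xi k _ rfl, hG.star_xi, fn_eq]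
  rw [h1, map_smul, map_sum]
  simp only [SetLike.val_smul, AddSubmonoidClass.coe_finsetSum, h2, mul_smul_comm,
    ← Finset.smul_sum]
  rw [smul_smul, mul_inv_cancel₀ hG.Lam_ne, one_smul]
  simp only [Finset.mul_sum, ← mul_assoc, ← map_mul]
  rw [Finset.sum_comm]
  simp only [← Finset.sum_mul, ← map_sum, hG.sphW_mul_sphN]
  simp

lemma existsUnique_hodgeStar :
    ∃! H : formsDeg N q r 1 →ₗ[ℂ] formsDeg N q r 2, IsHodgeStar N q r H := by
  refine ⟨hG.star, hG.isHodgeStar_star, fun H hH => LinearMap.ext fun α => ?_⟩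
  obtain ⟨c, rfl⟩ := hG.frameEquiv.surjective α
  have h1 : hG.frameEquiv c = ∑ a, (⟨fnHom N q r (c a) * theta N q r a,
      hG.fn_mul_mem _ _ (hG.theta_mem a)⟩ : formsDeg N q r 1) := by
    apply Subtype.ext
    rw [coe_frameEquiv]
    simp
  have h2 : ∀ a, (H ⟨fnHom N q r (c a) * theta N q r a, hG.fn_mul_mem _ _ (hG.theta_mem a)⟩ :
      Forms N q r) = fnHom N q r (c a) * starTheta N q r a := by
    intro a
    rw [hH.left (c a) ⟨theta N q r a, hG.theta_mem a⟩ _ rfl, hG.hodgeStar_theta hH, fn_eq]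
  apply Subtype.ext
  rw [hG.coe_star, h1, map_sum]
  simp only [AddSubmonoidClass.coe_finsetSum, h2]

end Generic
end forms

/-! ### The admissible values of `q` -/

lemma exp_add_inv (θ : ℝ) : Complex.exp (Complex.I * θ) + (Complex.exp (Complex.I * θ))⁻¹ =
    (2 * Real.cos θ : ℝ) := by
  rw [← Complex.exp_neg, Complex.ofReal_mul, Complex.ofReal_cos, Complex.cos]
  push_cast
  ring_nf

/-- For real `q` the sums of even powers in the numerators are positive. For a phase, `|φ| < 1/(2N)`
gives `[2]_{q^k} = 2 cos(kπφ) > 0` when `k ≤ N`, and `[3]_q = 1 + [2]_{q²}`. -/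
lemma generic {N : ℕ} (hN : 1 ≤ N) {q : ℂ} {r : ℝ} (hr : r ≠ 0)
    (hq : (∃ t : ℝ, t ≠ 0 ∧ q = t) ∨
      (∃ φ : ℝ, |φ| < 1 / (2 * (N : ℝ)) ∧ q = Complex.exp (Complex.I * Real.pi * φ)))
    (hC : qnum N q * qnum (N + 2) q ≠ 0) (hL : qnum 2 (q ^ (N + 1)) ≠ 0) : Generic N q r := by
  have hr' : (r : ℂ) ≠ 0 := by exact_mod_cast hr
  have hroot : rootNN N q ≠ 0 := csqrt_ne_zero hC
  rcases hq with ⟨t, ht, rfl⟩ | ⟨φ, hφ, hqφ⟩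
  · have ht' : (t : ℂ) ≠ 0 := by exact_mod_cast ht
    refine ⟨ht', hr', ?_, ?_, ?_, hroot, hL⟩
    · rw [qnum_two]
      field_simp
      norm_cast
      positivity
    · rw [qnum_three]
      field_simp
      norm_cast
      positivity
    · rw [qnum_two]
      field_simp
      norm_cast
      positivity
  · have hqθ : ∀ k : ℕ, q ^ k = Complex.exp (Complex.I * (k * (Real.pi * φ) : ℝ)) := by
      intro k
      rw [hqφ, ← Complex.exp_nat_mul]
      push_cast
      ring_nf
    have hq0 : q ≠ 0 := by rw [hqφ]; exact Complex.exp_ne_zero _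
    have hN' : (1 : ℝ) ≤ N := by exact_mod_cast hN
    have hcos : ∀ k : ℕ, k ≤ N → 0 < Real.cos (k * (Real.pi * φ)) := by
      intro k hk
      have hk' : (k : ℝ) ≤ N := by exact_mod_cast hk
      have h1 : |k * (Real.pi * φ)| < Real.pi / 2 := by
        rw [abs_mul, abs_mul, abs_of_pos Real.pi_pos, Nat.abs_cast]
        rw [lt_div_iff₀ (by positivity)] at hφ
        have h2 : (k : ℝ) * |φ| ≤ N * |φ| := by gcongr
        nlinarith [Real.pi_pos]
      exact Real.cos_pos_of_mem_Ioo (abs_lt.1 h1)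
    have h2 : ∀ k : ℕ, k ≤ N → qnum 2 (q ^ k) ≠ 0 := by
      intro k hk
      rw [qnum_two, hqθ, exp_add_inv]
      exact_mod_cast (mul_pos two_pos (hcos k hk)).ne'
    -- The bound reaches `k = 2` only if `N ≥ 2`. For `N = 1` the numbers `[3]_q = [N+2]_q` and
    -- `[2]_{q²} = [2]_{q^{N+1}}` are nonzero by assumption.
    have hcase : N = 1 ∨ 2 ≤ N := by omega
    refine ⟨hq0, hr', by simpa using h2 1 hN, ?_, ?_, hroot, hL⟩
    · rcases hcase with rfl | hN2
      · exact right_ne_zero_of_mul hC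
      · rw [qnum_three, add_right_comm, hqθ, exp_add_inv]
        have := hcos 2 hN2
        norm_cast
        positivity
    · rcases hcase with rfl | hN2
      · exact hL
      · exact h2 2 hN2

/-! ### The differential in the frame. -/

namespace Generic

variable {N : ℕ} {q : ℂ} {r : ℝ} (hG : Generic N q r)
include hG

lemma dZero_eq (f : Sphere N q) :
    dZero N q r f = ∑ a, fn N q r (lam N q r a * f - f * lam N q r a) * theta N q r a := by
  simp only [dZero, fn_eq, hG.Theta_eq, Finset.sum_mul, Finset.mul_sum, ← Finset.sum_sub_distrib,
    map_sub, map_mul, sub_mul, mul_assoc, hG.theta_mul_fn]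

lemma anticommutator_Theta (α : Forms N q r)
    (hα : ∀ f, α * fnHom N q r f = fnHom N q r f * α) :
    Theta N q r * α + α * Theta N q r =
      ∑ b, fnHom N q r (lam N q r b) * (α * theta N q r b + theta N q r b * α) := by
  simp only [hG.Theta_eq, Finset.sum_mul, Finset.mul_sum, mul_add, Finset.sum_add_distrib,
    ← mul_assoc, hα]
  exact add_comm _ _

lemma dOne_theta {H : formsDeg N q r 1 →ₗ[ℂ] formsDeg N q r 2} (hH : IsHodgeStar N q r H)
    (a : Fin 3) : dOne N q r H ⟨theta N q r a, hG.theta_mem a⟩ =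
      ∑ b, fn N q r (lam N q r b)
          * (theta N q r a * theta N q r b + theta N q r b * theta N q r a)
        + (q ^ 2 * qnum 2 (q ^ 2))⁻¹ •
          ∑ b, ∑ c, eps q b c a • (theta N q r c * theta N q r b) := by
  rw [dOne, hG.hodgeStar_theta hH, starTheta, hG.anticommutator_Theta _ (hG.theta_mul_fn a)]
  generalize (q ^ 2 * qnum 2 (q ^ 2))⁻¹ = c
  rw [sub_eq_iff_eq_add, add_assoc, ← add_smul, add_neg_cancel, zero_smul, add_zero]
  rfl

end Generic

end QFuzzy

open QFuzzy in
theorem mainTheorem2 (N : ℕ) (hN : 1 ≤ N) (q : ℂ) (r : ℝ) (hr : r ≠ 0)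
    (hq : (∃ t : ℝ, t ≠ 0 ∧ q = t) ∨
      (∃ φ : ℝ, |φ| < 1 / (2 * (N : ℝ)) ∧ q = Complex.exp (Complex.I * Real.pi * φ)))
    (hC : qnum N q * qnum (N + 2) q ≠ 0)
    (hL : qnum 2 (q ^ (N + 1)) ≠ 0) :
    -- `[θ^a, f] = 0`, `df = [λ_a, f] θ^a`, `Θ = λ_a θ^a`
    (∀ (a : Fin 3) (f : Sphere N q),
      theta N q r a * fn N q r f = fn N q r f * theta N q r a) ∧
    (∀ f : Sphere N q,
      dZero N q r f = ∑ a, fn N q r (lam N q r a * f - f * lam N q r a) * theta N q r a) ∧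
    (Theta N q r = ∑ a, fn N q r (lam N q r a) * theta N q r a) ∧
    -- the relations of the `λ_a`
    (∑ a, ∑ b, g q b a • (lam N q r a * lam N q r b)
      = algebraMap ℂ (Sphere N q) ((r : ℂ) ^ 2 / (q ^ 4 * Lam N q r ^ 2))) ∧
    (∀ c : Fin 3, ∑ a, ∑ b, eps q b a c • (lam N q r a * lam N q r b)
      = (-(q ^ 2)⁻¹) • lam N q r c) ∧
    -- `θ^a θ^b = - q² R̂^{ba}_{cd} θ^d θ^c`
    (∀ a b : Fin 3, theta N q r a * theta N q r b
      = (-q ^ 2) • ∑ c, ∑ d, Rhat q b a c d • (theta N q r d * theta N q r c)) ∧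
    -- `θ^a θ^b θ^c = - Λ_N² q⁶ / r² ε^{cba} Θ³`
    (∀ a b c : Fin 3, theta N q r a * theta N q r b * theta N q r c
      = (-(Lam N q r ^ 2 * q ^ 6 / (r : ℂ) ^ 2) * epsUp q c b a) • Theta N q r ^ 3) ∧
    -- the Hodge star is well defined, with the formulas for `*_H θ^a` and `dθ^a`
    (∃ hθ : ∀ a, theta N q r a ∈ formsDeg N q r 1,
      (∃! H : formsDeg N q r 1 →ₗ[ℂ] formsDeg N q r 2, IsHodgeStar N q r H) ∧
      ∀ H : formsDeg N q r 1 →ₗ[ℂ] formsDeg N q r 2, IsHodgeStar N q r H → ∀ a : Fin 3,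
        ((H ⟨theta N q r a, hθ a⟩ : Forms N q r)
          = (-(q ^ 2 * qnum 2 (q ^ 2))⁻¹) •
            ∑ b, ∑ c, eps q b c a • (theta N q r c * theta N q r b)) ∧
        (dOne N q r H ⟨theta N q r a, hθ a⟩
          = ∑ b, fn N q r (lam N q r b)
              * (theta N q r a * theta N q r b + theta N q r b * theta N q r a)
            + (q ^ 2 * qnum 2 (q ^ 2))⁻¹ •
              ∑ b, ∑ c, eps q b c a • (theta N q r c * theta N q r b))) ∧
    -- the `θ^a` are a frame: `Ω¹` is free with basis `θ^a`, and `Ω³` is free on `Θ³`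
    (∀ α ∈ formsDeg N q r 1, ∃! c : Fin 3 → Sphere N q,
      α = ∑ a, fn N q r (c a) * theta N q r a) ∧
    (∀ α ∈ formsDeg N q r 3, ∃! f : Sphere N q, α = fn N q r f * Theta N q r ^ 3) := by
  have hG := generic hN hr hq hC hL
  exact ⟨hG.theta_mul_fn, hG.dZero_eq, hG.Theta_eq, hG.g_lam_lam, hG.eps_lam_lam,
    hG.theta_mul_theta, hG.theta_mul_theta_mul_theta,
    ⟨hG.theta_mem, hG.existsUnique_hodgeStar,
      fun _ hH a => ⟨hG.hodgeStar_theta hH a, hG.dOne_theta hH a⟩⟩,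
    fun _ hα => hG.existsUnique_frame hα, fun _ hα => hG.existsUnique_volume hα⟩
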